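/- Let $(V,g)$ be a spacetime, that is, a connected Hausdorff $C^\infty$ manifold $V$ of dimension $4$ with a smooth metric $g$ of signature $(-,+,+,+)$. A smooth vector field $X$ is Killing if $\mathcal L_X g=0$, and it is integrable if $\boldsymbol X\wedge d\boldsymbol X=0$, where $\boldsymbol X=g(X,\cdot)$. The spacetime is stationary if it admits an everywhere timelike Killing vector field, and static if it admits an everywhere timelike integrable Killing vector field. A group $G_r$ of (local) isometries is given by its generators, an $r$-dimensional real Lie algebra of Killing vector fields on $V$; it is Abelian if these commute. A $G_2$ acts on spacelike surfaces $S_2$ if the nonzero tangent vectors of all its orbits are spacelike and its orbits are $2$-dimensional through the points of a dense set (so lower-dimensional orbits, as on an axis of symmetry, are allowed). An Abelian $G_2$ acts orthogonally transitively if $\boldsymbol\xi\wedge\boldsymbol\eta\wedge d\boldsymbol\xi=0$ and $\boldsymbol\xi\wedge\boldsymbol\eta\wedge d\boldsymbol\eta=0$ for all its generators $\xi,\eta$. If $(V,g)$ is stationary but not static, then there is no Abelian group $G_3$ of (local) isometries of $(V,g)$ that contains both a one-parameter group generated by an everywhere timelike Killing vector field and a subgroup $G_2$ which acts on spacelike surfaces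 $S_2$ and is orthogonally transitive. -/

import Mathlib

open scoped Manifold ContDiff Bundle

noncomputable section

namespace Spacetime

variable {V : Type*} [TopologicalSpace V] [ChartedSpace (EuclideanSpace ℝ (Fin 4)) V]
  [IsManifold (𝓡 4) ∞ V]

/-- (Not necessarily continuous) vector fields on a 4-dimensional manifold `V`. -/
abbrev VecField (V : Type*) [TopologicalSpace V] [ChartedSpace (EuclideanSpace ℝ (Fin 4)) V] :
    Type _ :=
  Π p : V, TangentSpace (𝓡 4) p

/-- The vector field `X` is `C^∞` at `p`. -/
def SmoothFieldAt (X : VecField V) (p : V) : Prop :=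
  ContMDiffAt (𝓡 4) (𝓡 4).tangent ∞
    (fun q ↦ (⟨q, X q⟩ : TangentBundle (𝓡 4) V)) p

/-- A smooth Lorentzian metric of signature `(-,+,+,+)` on a 4-dimensional manifold. -/
structure LorentzianMetric (V : Type*) [TopologicalSpace V]
    [ChartedSpace (EuclideanSpace ℝ (Fin 4)) V] [IsManifold (𝓡 4) ∞ V] where
  /-- The scalar product on each tangent space. -/
  val (p : V) : TangentSpace (𝓡 4) p →L[ℝ] TangentSpace (𝓡 4) p →L[ℝ] ℝ
  symm (p : V) (v w : TangentSpace (𝓡 4) p) : val p v w = val p w v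
  /-- Every tangent space has a (pseudo-)orthonormal basis with exactly one timelike vector. -/
  signature (p : V) : ∃ e : Module.Basis (Fin 4) ℝ (TangentSpace (𝓡 4) p),
    ∀ i j, val p (e i) (e j) = if i = j then (if i = 0 then -1 else 1) else 0
  contMDiff : ContMDiff (𝓡 4)
    ((𝓡 4).prod 𝓘(ℝ, EuclideanSpace ℝ (Fin 4) →L[ℝ] EuclideanSpace ℝ (Fin 4) →L[ℝ] ℝ)) ∞
    (fun p ↦ Bundle.TotalSpace.mk'
      (EuclideanSpace ℝ (Fin 4) →L[ℝ] EuclideanSpace ℝ (Fin 4) →L[ℝ] ℝ)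
      (E := fun q : V ↦ TangentSpace (𝓡 4) q →L[ℝ] TangentSpace (𝓡 4) q →L[ℝ] ℝ) p (val p))

/-- The function `g(X, Y)`. For fixed `X`, this is the value on `Y` of the 1-form metrically
equivalent to `X`. -/
def LorentzianMetric.inner (g : LorentzianMetric V) (X Y : VecField V) : V → ℝ :=
  fun p ↦ g.val p (X p) (Y p)

/-- The derivative `X(f)` of the function `f` along the vector field `X`. -/
def dirDeriv (X : VecField V) (f : V → ℝ) : V → ℝ :=
  fun p ↦ mvfderiv (𝓡 4) f p (X p)

/-- The value `dω(X, Y) = X(ω(Y)) - Y(ω(X)) - ω([X, Y])` of the exterior derivative of the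
1-form `ω = g(ξ, ·)`. -/
def LorentzianMetric.d (g : LorentzianMetric V) (ξ X Y : VecField V) : V → ℝ :=
  fun p ↦ dirDeriv X (g.inner ξ Y) p - dirDeriv Y (g.inner ξ X) p
    - g.inner ξ (VectorField.mlieBracket (𝓡 4) X Y) p

/-- A Killing vector field: a smooth vector field `X` whose Lie derivative of the metric,
`(L_X g)(Y, Z) = X(g(Y, Z)) - g([X, Y], Z) - g(Y, [X, Z])`, vanishes. -/
structure IsKilling (g : LorentzianMetric V) (X : VecField V) : Prop where
  smooth : ∀ p, SmoothFieldAt X p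
  lie_metric : ∀ p, ∀ Y Z : VecField V, SmoothFieldAt Y p → SmoothFieldAt Z p →
    dirDeriv X (g.inner Y Z) p
      - g.inner (VectorField.mlieBracket (𝓡 4) X Y) Z p
      - g.inner Y (VectorField.mlieBracket (𝓡 4) X Z) p = 0

/-- `X` is timelike everywhere. -/
def IsTimelike (g : LorentzianMetric V) (X : VecField V) : Prop :=
  ∀ p, g.inner X X p < 0

/-- `X` is integrable (hypersurface-orthogonal): the 3-form `𝐗 ∧ d𝐗` vanishes, where `𝐗` is the
1-form metrically equivalent to `X`. -/
def IsIntegrable (g : LorentzianMetric V) (X : VecField V) : Prop :=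
  ∀ p, ∀ Y : Fin 3 → VecField V, (∀ i, SmoothFieldAt (Y i) p) →
    ∑ σ : Equiv.Perm (Fin 3), ((Equiv.Perm.sign σ : ℤ) : ℝ) *
      (g.inner X (Y (σ 0)) p * g.d X (Y (σ 1)) (Y (σ 2)) p) = 0

/-- The 4-form `𝛏 ∧ 𝛈 ∧ d𝛏` vanishes. -/
def WedgeWedgeDZero (g : LorentzianMetric V) (ξ η : VecField V) : Prop :=
  ∀ p, ∀ Y : Fin 4 → VecField V, (∀ i, SmoothFieldAt (Y i) p) →
    ∑ σ : Equiv.Perm (Fin 4), ((Equiv.Perm.sign σ : ℤ) : ℝ) *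
      (g.inner ξ (Y (σ 0)) p * g.inner η (Y (σ 1)) p * g.d ξ (Y (σ 2)) (Y (σ 3)) p) = 0

/-- A spacetime is stationary if it has a timelike Killing vector field. -/
def IsStationary (g : LorentzianMetric V) : Prop :=
  ∃ ζ : VecField V, IsKilling g ζ ∧ IsTimelike g ζ

/-- A spacetime is static if it has an integrable timelike Killing vector field. -/
def IsStatic (g : LorentzianMetric V) : Prop :=
  ∃ s : VecField V, IsKilling g s ∧ IsTimelike g s ∧ IsIntegrable g s

/-- `𝔤` is the Lie algebra of infinitesimal generators of an `r`-parameter group `G_r` of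
(local) isometries: an `r`-dimensional Lie algebra of Killing vector fields. -/
structure IsIsometryAlgebra (g : LorentzianMetric V) (r : ℕ) (𝔤 : Submodule ℝ (VecField V)) :
    Prop where
  killing : ∀ X ∈ 𝔤, IsKilling g X
  bracket_mem : ∀ X ∈ 𝔤, ∀ Y ∈ 𝔤, VectorField.mlieBracket (𝓡 4) X Y ∈ 𝔤
  rank_eq : Module.rank ℝ 𝔤 = r

/-- The generators commute. -/
def IsAbelian (𝔤 : Submodule ℝ (VecField V)) : Prop :=
  ∀ X ∈ 𝔤, ∀ Y ∈ 𝔤, VectorField.mlieBracket (𝓡 4) X Y = 0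

/-- The tangent space at `p` of the orbit through `p` of the group generated by `𝔤`. -/
def orbitTangent (𝔤 : Submodule ℝ (VecField V)) (p : V) : Submodule ℝ (TangentSpace (𝓡 4) p) :=
  𝔤.map (LinearMap.proj p)

/-- The group generated by `𝔤` acts on spacelike surfaces `S_2`: no orbit has a null or timelike
tangent vector, and the orbits are 2-dimensional, except that they may degenerate on
a set with empty interior (such as the axis of an axial symmetry). -/
structure ActsOnSpacelikeSurfaces (g : LorentzianMetric V) (𝔤 : Submodule ℝ (VecField V)) :
    Prop where
  spacelike : ∀ p, ∀ v ∈ orbitTangent 𝔤 p, v ≠ 0 → 0 < g.val p v v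
  dense_two_dim : Dense {p : V | Module.finrank ℝ (orbitTangent 𝔤 p) = 2}

/-- The group `G_2` with generators `𝔤` acts orthogonally transitively:
`𝛏 ∧ 𝛈 ∧ d𝛏 = 0` and `𝛏 ∧ 𝛈 ∧ d𝛈 = 0` for all generators `ξ`, `η`
(the second equation is the first one with `ξ` and `η` exchanged). -/
def IsOrthogonallyTransitive (g : LorentzianMetric V) (𝔤 : Submodule ℝ (VecField V)) : Prop :=
  ∀ ξ ∈ 𝔤, ∀ η ∈ 𝔤, WedgeWedgeDZero g ξ η

end Spacetime

end

/-!
Let `ζ` be the timelike generator and `ξ`, `η` generators of `G₂`. The idea is that the orthogonal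
projection of `ζ` to the orbits of `G₂` is a *constant* combination `τ = a ξ + b η`, so that
`s = ζ - τ` is again a Killing field; it is timelike, because `τ` is spacelike and orthogonal to `s`,
and it is integrable, because it is orthogonal to the orbits. Thus the spacetime would be static.

*Where the orbits are two-dimensional.* For commuting Killing fields `K`, `L` and the 1-form
`𝐊 = g(K, ·)`, Cartan's formula gives `d(g(K, L)) = -i_L d𝐊` (`fderiv_metric_eq_dFlat`).
Orthogonal transitivity says that `d𝛏` and `d𝛈` vanish on pairs of vectors orthogonal to the orbits,
in particular on pairs containing `ζ - a ξ - b η`, where `a`, `b` are the coefficients of the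
projection at the point. Hence the derivatives of `g(ξ, ζ) = a g(ξ, ξ) + b g(ξ, η)` and of
`g(η, ζ) = a g(ξ, η) + b g(η, η)` involve no derivative of `a` and `b`, and these are locally
constant (`OrthTransitiveTriple.eventually_projCoeff_eq`). If `s` is orthogonal to the orbits, then
`i_ξ d𝐬 = i_η d𝐬 = 0`, so the 3-form `𝐬 ∧ d𝐬` lives on a two-dimensional quotient and vanishes
(`OrthTransitiveTriple.wedge_dFlat_eq_zero`, which extends this to all points by density).

*Where the orbits degenerate.* The set of two-dimensional orbits is open and dense, but a priori
`a` and `b` could take different values on its components. At a point `x₀` with a degenerate orbit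
choose generators with `ξ(x₀) = 0`. The linearization `A` of `ξ` at `x₀` is skew for `g` and kills
`ζ(x₀)`, so it is an infinitesimal rotation about a timelike axis. It is nonzero, since a Killing
field with vanishing 1-jet vanishes nearby (`IsKillingAt.eventually_eq_zero`). If `η` vanished at
`x₀` as well, its linearization would be a commuting rotation, hence a multiple of `A`
(`commuting_skew_proportional`), and some generator would have vanishing 1-jet. Otherwise the
degenerate orbits near `x₀` lie in the zero set of `F = ξ - (g(ξ, η) / g(η, η)) η`, whose derivative
at `x₀` is `A`. As `A` is injective on a plane (`skew_injective_on_plane`), `F` has at most one zero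
on each slice parallel to this plane, and such a set does not disconnect a ball
(`eq_of_forall_slice_subsingleton`). So `a` and `b` are constant near `x₀`.

The element `τ` of the algebra found near a point is unique by density, and it is the same for all
points by connectedness (`OrthTransitiveAlgebra.exists_orthogonal`).
-/

namespace Spacetime

open Filter Topology

-- Needed to find the normed space structure on spaces of trilinear maps.
set_option maxSynthPendingDepth 3

/-! ### Unique continuation of Killing fields from their 1-jet -/

section Jet

variable {E F : Type*} [NormedAddCommGroup E] [NormedSpace ℝ E]
  [NormedAddCommGroup F] [NormedSpace ℝ F]

theorem eq_zero_on_ball_of_norm_fderiv_le {Y : E → F} {x₀ : E} {R K : ℝ}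
    (hY : ∀ x ∈ Metric.ball x₀ R, DifferentiableAt ℝ Y x) (h0 : Y x₀ = 0)
    (hK : ∀ x ∈ Metric.ball x₀ R, ‖fderiv ℝ Y x‖ ≤ K * ‖Y x‖) :
    ∀ x ∈ Metric.ball x₀ R, Y x = 0 := by
  intro x hx
  have hseg : ∀ t ∈ Set.Icc (0 : ℝ) 1, x₀ + t • (x - x₀) ∈ Metric.ball x₀ R := by
    intro t ht
    rw [Metric.mem_ball, dist_eq_norm] at hx ⊢
    rw [add_sub_cancel_left, norm_smul, Real.norm_eq_abs, abs_of_nonneg ht.1]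
    nlinarith [norm_nonneg (x - x₀), ht.2]
  have hderiv : ∀ t ∈ Set.Icc (0 : ℝ) 1,
      HasDerivAt (fun t : ℝ ↦ Y (x₀ + t • (x - x₀)))
        (fderiv ℝ Y (x₀ + t • (x - x₀)) (x - x₀)) t := by
    intro t ht
    have h1 : HasDerivAt (fun t : ℝ ↦ x₀ + t • (x - x₀)) (x - x₀) t := by
      simpa using ((hasDerivAt_id t).smul_const (x - x₀)).const_add x₀
    exact (hY _ (hseg t ht)).hasFDerivAt.comp_hasDerivAt t h1
  have := eq_zero_of_abs_deriv_le_mul_abs_self_of_eq_zero_right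
    (f := fun t : ℝ ↦ Y (x₀ + t • (x - x₀))) (K := K * ‖x - x₀‖) (a := 0) (b := 1)
    (fun t ht ↦ (hderiv t ht).continuousAt.continuousWithinAt)
    (fun t ht ↦ (hderiv t ⟨ht.1, ht.2.le⟩).hasDerivWithinAt) (by simpa using h0)
    (fun t ht ↦ by
      have ht' := hseg t ⟨ht.1, ht.2.le⟩
      calc _ ≤ ‖fderiv ℝ Y (x₀ + t • (x - x₀))‖ * ‖x - x₀‖ := ContinuousLinearMap.le_opNorm _ _
        _ ≤ K * ‖Y (x₀ + t • (x - x₀))‖ * ‖x - x₀‖ := by gcongr; exact hK _ ht'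
        _ = _ := by ring)
    1 (by simp)
  simpa using this

/-- The Killing equation at the point `x`, for a metric `G` and a vector field `X` on a vector
space: `(L_X G)(v, w) = 0` on constant vector fields `v`, `w`. -/
def IsKillingAt (G : E → E →L[ℝ] E →L[ℝ] ℝ) (X : E → E) (x : E) : Prop :=
  ∀ v w : E, fderiv ℝ G x (X x) v w + G x (fderiv ℝ X x v) w + G x v (fderiv ℝ X x w) = 0

variable {G : E → E →L[ℝ] E →L[ℝ] ℝ} {X : E → E} {x : E}

/-- The derivative of the Killing equation. -/
theorem IsKillingAt.second_fderiv (hG : ContDiffAt ℝ 2 G x) (hX : ContDiffAt ℝ 2 X x)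
    (hK : ∀ᶠ y in 𝓝 x, IsKillingAt G X y) (z v w : E) :
    G x (fderiv ℝ (fderiv ℝ X) x z v) w + G x v (fderiv ℝ (fderiv ℝ X) x z w) =
      -(fderiv ℝ (fderiv ℝ G) x z (X x) v w + fderiv ℝ G x (fderiv ℝ X x z) v w
        + fderiv ℝ G x z (fderiv ℝ X x v) w + fderiv ℝ G x z v (fderiv ℝ X x w)) := by
  have hG1 : HasFDerivAt G (fderiv ℝ G x) x := (hG.differentiableAt (by simp)).hasFDerivAt
  have hX1 : HasFDerivAt X (fderiv ℝ X x) x := (hX.differentiableAt (by simp)).hasFDerivAt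
  have hG2 : HasFDerivAt (fderiv ℝ G) (fderiv ℝ (fderiv ℝ G) x) x :=
    ((hG.fderiv_right (m := 1) (by norm_num)).differentiableAt (by simp)).hasFDerivAt
  have hX2 : HasFDerivAt (fderiv ℝ X) (fderiv ℝ (fderiv ℝ X) x) x :=
    ((hX.fderiv_right (m := 1) (by norm_num)).differentiableAt (by simp)).hasFDerivAt
  have hv := hasFDerivAt_const (𝕜 := ℝ) v x
  have hw := hasFDerivAt_const (𝕜 := ℝ) w x
  have key := ((((hG2.clm_apply hX1).clm_apply hv).clm_apply hw).add
    ((hG1.clm_apply (hX2.clm_apply hv)).clm_apply hw)).add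
    ((hG1.clm_apply hv).clm_apply (hX2.clm_apply hw))
  have h0 := (hasFDerivAt_const (𝕜 := ℝ) (0 : ℝ) x).congr_of_eventuallyEq
    (hK.mono fun y hy ↦ hy v w)
  have := congrArg (fun L : E →L[ℝ] ℝ ↦ L z) (key.unique h0)
  simp at this
  linarith

/-- The second derivative of a Killing field is bounded by its 1-jet. As in the derivation of the
Koszul formula, `(z, v, w) ↦ G(D²X(z, v), w)` is symmetric in `z`, `v`, so it is determined by its
symmetrization in `v`, `w`, which the derivative of the Killing equation expresses by the 1-jet. -/
theorem IsKillingAt.abs_second_fderiv_le (hG : ContDiffAt ℝ 2 G x) (hX : ContDiffAt ℝ 2 X x)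
    (hK : ∀ᶠ y in 𝓝 x, IsKillingAt G X y) (hsymm : ∀ v w, G x v w = G x w v) {M : ℝ}
    (hM1 : ‖fderiv ℝ G x‖ ≤ M) (hM2 : ‖fderiv ℝ (fderiv ℝ G) x‖ ≤ M) (z v w : E) :
    |G x (fderiv ℝ (fderiv ℝ X) x z v) w| ≤
      6 * M * ‖(X x, fderiv ℝ X x)‖ * ‖z‖ * ‖v‖ * ‖w‖ := by
  have hM : 0 ≤ M := (norm_nonneg _).trans hM1
  set N := ‖(X x, fderiv ℝ X x)‖ with hN
  have hN1 : ‖X x‖ ≤ N := norm_fst_le (X x, fderiv ℝ X x)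
  have hN2 : ‖fderiv ℝ X x‖ ≤ N := norm_snd_le (X x, fderiv ℝ X x)
  have hS : ∀ a b, fderiv ℝ (fderiv ℝ X) x a b = fderiv ℝ (fderiv ℝ X) x b a :=
    fun a b ↦ hX.isSymmSndFDerivAt (by simp) a b
  have hX' : ∀ a, ‖fderiv ℝ X x a‖ ≤ N * ‖a‖ := fun a ↦
    (ContinuousLinearMap.le_opNorm _ _).trans (by gcongr)
  have hG' : ∀ a b c, |fderiv ℝ G x a b c| ≤ M * ‖a‖ * ‖b‖ * ‖c‖ := by
    intro a b c
    calc _ ≤ ‖fderiv ℝ G x a b‖ * ‖c‖ := ContinuousLinearMap.le_opNorm _ _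
      _ ≤ ‖fderiv ℝ G x a‖ * ‖b‖ * ‖c‖ := by gcongr; exact ContinuousLinearMap.le_opNorm _ _
      _ ≤ ‖fderiv ℝ G x‖ * ‖a‖ * ‖b‖ * ‖c‖ := by gcongr; exact ContinuousLinearMap.le_opNorm _ _
      _ ≤ _ := by gcongr
  have hG'' : ∀ a b c d, |fderiv ℝ (fderiv ℝ G) x a b c d| ≤ M * ‖a‖ * ‖b‖ * ‖c‖ * ‖d‖ := by
    intro a b c d
    calc _ ≤ ‖fderiv ℝ (fderiv ℝ G) x a b c‖ * ‖d‖ := ContinuousLinearMap.le_opNorm _ _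
      _ ≤ ‖fderiv ℝ (fderiv ℝ G) x a b‖ * ‖c‖ * ‖d‖ := by
        gcongr; exact ContinuousLinearMap.le_opNorm _ _
      _ ≤ ‖fderiv ℝ (fderiv ℝ G) x a‖ * ‖b‖ * ‖c‖ * ‖d‖ := by
        gcongr; exact ContinuousLinearMap.le_opNorm _ _
      _ ≤ ‖fderiv ℝ (fderiv ℝ G) x‖ * ‖a‖ * ‖b‖ * ‖c‖ * ‖d‖ := by
        gcongr; exact ContinuousLinearMap.le_opNorm _ _
      _ ≤ _ := by gcongr
  have hB : ∀ a b c, |G x (fderiv ℝ (fderiv ℝ X) x a b) c + G x b (fderiv ℝ (fderiv ℝ X) x a c)|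
      ≤ 4 * (M * N * ‖a‖ * ‖b‖ * ‖c‖) := by
    intro a b c
    rw [IsKillingAt.second_fderiv hG hX hK, abs_neg]
    have h1 : |fderiv ℝ (fderiv ℝ G) x a (X x) b c| ≤ M * N * ‖a‖ * ‖b‖ * ‖c‖ := by
      calc _ ≤ M * ‖a‖ * ‖X x‖ * ‖b‖ * ‖c‖ := hG'' _ _ _ _
        _ ≤ M * ‖a‖ * N * ‖b‖ * ‖c‖ := by gcongr
        _ = _ := by ring
    have h2 : |fderiv ℝ G x (fderiv ℝ X x a) b c| ≤ M * N * ‖a‖ * ‖b‖ * ‖c‖ := by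
      calc _ ≤ M * ‖fderiv ℝ X x a‖ * ‖b‖ * ‖c‖ := hG' _ _ _
        _ ≤ M * (N * ‖a‖) * ‖b‖ * ‖c‖ := by gcongr; exact hX' _
        _ = _ := by ring
    have h3 : |fderiv ℝ G x a (fderiv ℝ X x b) c| ≤ M * N * ‖a‖ * ‖b‖ * ‖c‖ := by
      calc _ ≤ M * ‖a‖ * ‖fderiv ℝ X x b‖ * ‖c‖ := hG' _ _ _
        _ ≤ M * ‖a‖ * (N * ‖b‖) * ‖c‖ := by gcongr; exact hX' _
        _ = _ := by ring
    have h4 : |fderiv ℝ G x a b (fderiv ℝ X x c)| ≤ M * N * ‖a‖ * ‖b‖ * ‖c‖ := by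
      calc _ ≤ M * ‖a‖ * ‖b‖ * ‖fderiv ℝ X x c‖ := hG' _ _ _
        _ ≤ M * ‖a‖ * ‖b‖ * (N * ‖c‖) := by gcongr; exact hX' _
        _ = _ := by ring
    rw [abs_le] at h1 h2 h3 h4 ⊢
    constructor <;> linarith [h1.1, h1.2, h2.1, h2.2, h3.1, h3.2, h4.1, h4.2]
  have e1 := hB z v w
  have e2 := hB v w z
  have e3 := hB w z v
  rw [hS v w, hsymm w] at e2
  rw [hS w z, hsymm z, hS w v] at e3
  rw [hsymm v] at e1
  rw [hS z v] at e1 ⊢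
  have c1 : 4 * (M * N * ‖v‖ * ‖w‖ * ‖z‖) = 4 * (M * N * ‖z‖ * ‖v‖ * ‖w‖) := by ring
  have c2 : 4 * (M * N * ‖w‖ * ‖z‖ * ‖v‖) = 4 * (M * N * ‖z‖ * ‖v‖ * ‖w‖) := by ring
  rw [c1] at e2
  rw [c2] at e3
  have c3 : 6 * M * N * ‖z‖ * ‖v‖ * ‖w‖ = 6 * (M * N * ‖z‖ * ‖v‖ * ‖w‖) := by ring
  rw [c3]
  rw [hS v w] at e3
  rw [abs_le] at e1 e2 e3 ⊢
  constructor <;> linarith [e1.1, e1.2, e2.1, e2.2, e3.1, e3.2]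

theorem _root_.ContDiffAt.exists_eventually_norm_fderiv_le {f : E → F} {x₀ : E}
    (hf : ContDiffAt ℝ 2 f x₀) :
    ∃ M : ℝ, ∀ᶠ x in 𝓝 x₀, ‖fderiv ℝ f x‖ ≤ M ∧ ‖fderiv ℝ (fderiv ℝ f) x‖ ≤ M := by
  have c1 : ContDiffAt ℝ 1 (fderiv ℝ f) x₀ := hf.fderiv_right (by norm_num)
  have c2 : ContDiffAt ℝ 0 (fderiv ℝ (fderiv ℝ f)) x₀ := c1.fderiv_right (by norm_num)
  refine ⟨max ‖fderiv ℝ f x₀‖ ‖fderiv ℝ (fderiv ℝ f) x₀‖ + 1, ?_⟩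
  have l1 : ‖fderiv ℝ f x₀‖ < max ‖fderiv ℝ f x₀‖ ‖fderiv ℝ (fderiv ℝ f) x₀‖ + 1 :=
    (le_max_left _ _).trans_lt (lt_add_one _)
  have l2 : ‖fderiv ℝ (fderiv ℝ f) x₀‖ < max ‖fderiv ℝ f x₀‖ ‖fderiv ℝ (fderiv ℝ f) x₀‖ + 1 :=
    (le_max_right _ _).trans_lt (lt_add_one _)
  filter_upwards [c1.continuousAt.norm.eventually_lt continuousAt_const l1,
    c2.continuousAt.norm.eventually_lt continuousAt_const l2] with x a b
  exact ⟨a.le, b.le⟩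

/-- A Killing field with vanishing 1-jet at a point vanishes near that point: by
`IsKillingAt.abs_second_fderiv_le` the pair `(X, DX)` satisfies a linear differential
inequality. -/
theorem IsKillingAt.eventually_eq_zero [FiniteDimensional ℝ E] {x₀ : E} (hG : ContDiffAt ℝ ∞ G x₀)
    (hX : ContDiffAt ℝ ∞ X x₀) (hK : ∀ᶠ x in 𝓝 x₀, IsKillingAt G X x)
    (hsymm : ∀ᶠ x in 𝓝 x₀, ∀ v w, G x v w = G x w v) (hnd : ∀ v, G x₀ v = 0 → v = 0)
    (h0 : X x₀ = 0) (h1 : fderiv ℝ X x₀ = 0) : ∀ᶠ x in 𝓝 x₀, X x = 0 := by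
  have hG2 : ContDiffAt ℝ 2 G x₀ := hG.of_le ENat.LEInfty.out
  have hX2 : ContDiffAt ℝ 2 X x₀ := hX.of_le ENat.LEInfty.out
  -- `G x` is bounded below, uniformly near `x₀`.
  obtain ⟨c, hc, hlow⟩ : ∃ c > 0, ∀ᶠ x in 𝓝 x₀, ∀ v, c * ‖v‖ ≤ ‖G x v‖ := by
    obtain ⟨K, hK0, hKa⟩ := (G x₀ : E →ₗ[ℝ] (E →L[ℝ] ℝ)).exists_antilipschitzWith
      (LinearMap.ker_eq_bot'.2 fun v hv ↦ hnd v hv)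
    have hK0' : (0 : ℝ) < K := hK0
    refine ⟨(K : ℝ)⁻¹ / 2, by positivity, ?_⟩
    have hcont := hG.continuousAt
    have : ∀ᶠ x in 𝓝 x₀, ‖G x - G x₀‖ < (K : ℝ)⁻¹ / 2 := by
      refine (hcont.sub continuousAt_const).norm.eventually_lt continuousAt_const ?_
      simpa using hK0'
    filter_upwards [this] with x hx v
    have e1 : ‖v‖ ≤ K * ‖G x₀ v‖ := by
      simpa using hKa.le_mul_norm_sub (x := v) (y := 0)
    have e1' : (K : ℝ)⁻¹ * ‖v‖ ≤ ‖G x₀ v‖ := by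
      rw [inv_mul_le_iff₀ hK0']; exact e1
    have e2 : ‖(G x - G x₀) v‖ ≤ (K : ℝ)⁻¹ / 2 * ‖v‖ :=
      (ContinuousLinearMap.le_opNorm _ _).trans (by gcongr)
    have e3 : ‖G x₀ v‖ ≤ ‖G x v‖ + ‖(G x - G x₀) v‖ := by
      have : G x₀ v = G x v - (G x - G x₀) v := by simp
      rw [this]; exact norm_sub_le _ _
    linarith
  obtain ⟨M, hM⟩ := hG2.exists_eventually_norm_fderiv_le
  have hev := hM.and <| hlow.and <| hK.eventually_nhds.and <| hsymm.and <|
    (hG2.eventually (by simp)).and (hX2.eventually (by simp))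
  obtain ⟨R, hR, hball⟩ := Metric.eventually_nhds_iff_ball.1 hev
  have hY := eq_zero_on_ball_of_norm_fderiv_le (Y := fun x ↦ (X x, fderiv ℝ X x)) (x₀ := x₀)
    (R := R) (K := 1 + 6 * M / c) (fun x hx ↦ by
      obtain ⟨-, -, -, -, -, hx⟩ := hball x hx
      exact (hx.differentiableAt (by simp)).prodMk
        ((hx.fderiv_right (m := 1) (by norm_num)).differentiableAt (by simp)))
    (by simp [h0, h1]) (fun x hx ↦ by
      obtain ⟨⟨m1, m2⟩, hl, hk, hs, hg, hx⟩ := hball x hx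
      have hM0 : 0 ≤ M := (norm_nonneg _).trans m1
      have d1 : DifferentiableAt ℝ X x := hx.differentiableAt (by simp)
      have d2 : DifferentiableAt ℝ (fderiv ℝ X) x :=
        (hx.fderiv_right (m := 1) (by norm_num)).differentiableAt (by simp)
      refine ContinuousLinearMap.opNorm_le_bound _ (by positivity) fun z ↦ ?_
      rw [(d1.hasFDerivAt.prodMk d2.hasFDerivAt).fderiv]
      set N := ‖(X x, fderiv ℝ X x)‖ with hN
      refine max_le ?_ ?_
      · calc ‖fderiv ℝ X x z‖ ≤ ‖fderiv ℝ X x‖ * ‖z‖ := ContinuousLinearMap.le_opNorm _ _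
          _ ≤ N * ‖z‖ := by gcongr; exact norm_snd_le (X x, fderiv ℝ X x)
          _ ≤ (1 + 6 * M / c) * N * ‖z‖ := by
            gcongr
            exact le_mul_of_one_le_left (norm_nonneg _) (le_add_of_nonneg_right (by positivity))
      · have : ‖fderiv ℝ (fderiv ℝ X) x z‖ ≤ 6 * M / c * N * ‖z‖ := by
          refine ContinuousLinearMap.opNorm_le_bound _ (by positivity) fun v ↦ ?_
          have b1 : ‖G x (fderiv ℝ (fderiv ℝ X) x z v)‖ ≤ 6 * M * N * ‖z‖ * ‖v‖ :=
            ContinuousLinearMap.opNorm_le_bound _ (by positivity) fun w ↦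
              IsKillingAt.abs_second_fderiv_le hg hx hk hs m1 m2 z v w
          have b2 := (hl (fderiv ℝ (fderiv ℝ X) x z v)).trans b1
          calc _ ≤ (6 * M * N * ‖z‖ * ‖v‖) / c := by rw [le_div_iff₀ hc]; linarith
            _ = _ := by ring
        refine this.trans ?_
        gcongr
        exact le_add_of_nonneg_left zero_le_one)
  filter_upwards [Metric.ball_mem_nhds x₀ hR] with x hx
  exact congrArg Prod.fst (hY x hx)

end Jet

/-! ### Locally constant functions off a set of codimension two -/

section Slices

variable {E F : Type*} [NormedAddCommGroup E] [NormedSpace ℝ E]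

theorem eq_of_segment_subset {S : Set E} {f : E → F} (hf : ∀ x ∈ S, ∀ᶠ y in 𝓝 x, f y = f x)
    {x y : E} (h : segment ℝ x y ⊆ S) : f x = f y :=
  (convex_segment x y).isPreconnected.induction₂ (fun a b ↦ f a = f b)
    (fun a ha ↦ ((hf a (h ha)).filter_mono nhdsWithin_le_nhds).mono fun _ h ↦ h.symm)
    (fun _ _ _ _ _ _ h h' ↦ h.trans h') (fun _ _ _ _ h ↦ h.symm)
    (left_mem_segment ℝ x y) (right_mem_segment ℝ x y)

/-- Let `Z` be a subset of an open convex set `B` which meets each slice parallel to the plane `P`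
spanned by two independent vectors in at most one point. A locally constant function on `B \ Z`
is constant along the slices. -/
theorem eq_of_sub_mem_plane {B Z : Set E} (hBo : IsOpen B) (hBc : Convex ℝ B) {e₁ e₂ : E}
    (hli : LinearIndependent ℝ ![e₁, e₂]) {P : Submodule ℝ E} (h₁ : e₁ ∈ P) (h₂ : e₂ ∈ P)
    (hZ : ∀ x ∈ B ∩ Z, ∀ y ∈ B ∩ Z, y - x ∈ P → x = y) {f : E → F}
    (hf : ∀ x ∈ B \ Z, ∀ᶠ y in 𝓝 x, f y = f x) {x y : E} (hx : x ∈ B \ Z) (hy : y ∈ B \ Z)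
    (hxy : y - x ∈ P) : f x = f y := by
  by_cases hseg : segment ℝ x y ⊆ B \ Z
  · exact eq_of_segment_subset hf hseg
  obtain ⟨z, hzs, hz⟩ := Set.not_subset.1 hseg
  have hzB : z ∈ B := hBc.segment_subset hx.1 hy.1 hzs
  have hzZ : z ∈ Z := by by_contra h; exact hz ⟨hzB, h⟩
  have hne : y - x ≠ 0 := by
    rintro h0
    rw [sub_eq_zero] at h0
    subst h0
    rw [segment_same] at hzs
    exact hx.2 (hzs ▸ hzZ)
  -- a vector of `P` transverse to the segment
  obtain ⟨w, hwP, hw⟩ : ∃ w ∈ P, ∀ c : ℝ, w ≠ c • (y - x) := by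
    by_contra! hcon
    obtain ⟨c₁, hc₁⟩ := hcon e₁ h₁
    obtain ⟨c₂, hc₂⟩ := hcon e₂ h₂
    have := LinearIndependent.pair_iff.1 hli c₂ (-c₁) (by
      rw [hc₁, hc₂, smul_smul, smul_smul, ← add_smul]; simp [mul_comm])
    have hc : c₁ = 0 := by simpa using this.2
    rw [hc, zero_smul] at hc₁
    have := LinearIndependent.pair_iff.1 hli 1 0 (by simp [hc₁])
    exact one_ne_zero this.1
  obtain ⟨ε, hε, hmB⟩ : ∃ ε : ℝ, ε ≠ 0 ∧ z + ε • w ∈ B := by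
    have hc : ContinuousAt (fun ε : ℝ ↦ z + ε • w) 0 := by fun_prop
    have : ∀ᶠ ε : ℝ in 𝓝 0, z + ε • w ∈ B :=
      hc.eventually (by simpa using hBo.mem_nhds hzB)
    obtain ⟨ε, h, h'⟩ := ((this.filter_mono nhdsWithin_le_nhds).and
      (self_mem_nhdsWithin : ∀ᶠ ε in 𝓝[≠] (0 : ℝ), ε ≠ 0)).exists
    exact ⟨ε, h', h⟩
  -- Both segments from the ends to the displaced point avoid `Z`.
  have havoid : ∀ a ∈ B \ Z, a - z ∈ P → (∃ c : ℝ, a - z = c • (y - x)) →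
      segment ℝ a (z + ε • w) ⊆ B \ Z := by
    rintro a ha haP ⟨c, hc⟩ p hp
    have hpB := hBc.segment_subset ha.1 hmB hp
    refine ⟨hpB, fun hpZ ↦ ?_⟩
    obtain ⟨s, t, -, -, hst, rfl⟩ := hp
    have hpz : s • a + t • (z + ε • w) - z = s • (a - z) + (t * ε) • w := by
      have hs : s = 1 - t := by linarith
      subst hs; module
    have hmem : s • a + t • (z + ε • w) - z ∈ P := by
      rw [hpz]; exact P.add_mem (P.smul_mem _ haP) (P.smul_mem _ hwP)
    have heq := hZ z ⟨hzB, hzZ⟩ _ ⟨hpB, hpZ⟩ hmem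
    rw [← heq, sub_self, hc] at hpz
    have ht : t = 0 := by
      by_contra ht
      refine hw (-(s * c) / (t * ε)) ?_
      have hte : t * ε ≠ 0 := mul_ne_zero ht hε
      have : (t * ε) • w = (-(s * c)) • (y - x) := by
        rw [smul_smul] at hpz
        rw [neg_smul]; exact eq_neg_of_add_eq_zero_right hpz.symm
      rw [div_eq_inv_mul, ← smul_smul, ← this, smul_smul, inv_mul_cancel₀ hte, one_smul]
    have hs : s = 1 := by linarith
    rw [ht, hs] at heq
    simp at heq
    exact ha.2 (heq ▸ hzZ)
  obtain ⟨s, t, -, -, hst, rfl⟩ := hzs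
  have hs : s = 1 - t := by linarith
  subst hs
  have hxz : x - ((1 - t) • x + t • y) = (-t) • (y - x) := by module
  have hyz : y - ((1 - t) • x + t • y) = (1 - t) • (y - x) := by module
  exact (eq_of_segment_subset hf (havoid x hx (hxz ▸ P.smul_mem _ hxy) ⟨_, hxz⟩)).trans
    (eq_of_segment_subset hf (havoid y hy (hyz ▸ P.smul_mem _ hxy) ⟨_, hyz⟩)).symm

/-- A set which meets each slice parallel to a fixed plane in at most one point does not
disconnect an open convex set. -/
theorem eq_of_forall_slice_subsingleton {B Z : Set E} (hBo : IsOpen B) (hBc : Convex ℝ B)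
    {e₁ e₂ : E} (hli : LinearIndependent ℝ ![e₁, e₂]) {P : Submodule ℝ E} (h₁ : e₁ ∈ P)
    (h₂ : e₂ ∈ P) (hZ : ∀ x ∈ B ∩ Z, ∀ y ∈ B ∩ Z, y - x ∈ P → x = y) (hBZ : IsOpen (B \ Z))
    {f : E → F} (hf : ∀ x ∈ B \ Z, ∀ᶠ y in 𝓝 x, f y = f x) {x y : E} (hx : x ∈ B \ Z)
    (hy : y ∈ B \ Z) : f x = f y := by
  have he₁ : e₁ ≠ 0 := fun h ↦
    one_ne_zero (LinearIndependent.pair_iff.1 hli 1 0 (by simp [h])).1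
  have hslice : ∀ a ∈ B, ∃ u ∈ P, a + u ∈ B \ Z := by
    intro a ha
    by_cases haZ : a ∈ Z
    · have hc : ContinuousAt (fun ε : ℝ ↦ a + ε • e₁) 0 := by fun_prop
      have : ∀ᶠ ε : ℝ in 𝓝 0, a + ε • e₁ ∈ B :=
        hc.eventually (by simpa using hBo.mem_nhds ha)
      obtain ⟨ε, h, h'⟩ := ((this.filter_mono nhdsWithin_le_nhds).and
        (self_mem_nhdsWithin : ∀ᶠ ε in 𝓝[≠] (0 : ℝ), ε ≠ 0)).exists
      refine ⟨ε • e₁, P.smul_mem _ h₁, h, fun hz ↦ ?_⟩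
      have := hZ a ⟨ha, haZ⟩ _ ⟨h, hz⟩ (by simpa using P.smul_mem ε h₁)
      simp [he₁] at this
      exact h' this
    · exact ⟨0, P.zero_mem, by simpa using ⟨ha, haZ⟩⟩
  have key := (convex_segment x y).isPreconnected.induction₂
    (fun a b ↦ ∀ u ∈ P, ∀ v ∈ P, a + u ∈ B \ Z → b + v ∈ B \ Z → f (a + u) = f (b + v))
    (fun a ha ↦ by
      obtain ⟨u₀, hu₀, hau₀⟩ := hslice a (hBc.segment_subset hx.1 hy.1 ha)
      have hc : ContinuousAt (fun b ↦ b + u₀) a := by fun_prop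
      filter_upwards [(hc.eventually (hf _ hau₀)).filter_mono nhdsWithin_le_nhds,
        (hc.eventually (hBZ.mem_nhds hau₀)).filter_mono nhdsWithin_le_nhds] with b hb hb' u hu v hv
        hau hbv
      rw [eq_of_sub_mem_plane hBo hBc hli h₁ h₂ hZ hf hau hau₀
          (by simpa using P.sub_mem hu₀ hu), ← hb,
        eq_of_sub_mem_plane hBo hBc hli h₁ h₂ hZ hf hb' hbv (by simpa using P.sub_mem hv hu₀)])
    (fun a b c _ hb _ hab hbc u hu v hv hau hcv ↦ by
      obtain ⟨w, hw, hbw⟩ := hslice b (hBc.segment_subset hx.1 hy.1 hb)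
      exact (hab u hu w hw hau hbw).trans (hbc w hw v hv hbw hcv))
    (fun a b _ _ hab u hu v hv h h' ↦ (hab v hv u hu h' h).symm)
    (left_mem_segment ℝ x y) (right_mem_segment ℝ x y)
  simpa using key 0 P.zero_mem 0 P.zero_mem (by simpa using hx) (by simpa using hy)

end Slices

/-! ### Infinitesimal rotations about a timelike axis -/

section Rotation

variable {E : Type*} [AddCommGroup E] [Module ℝ E] {g : E →ₗ[ℝ] E →ₗ[ℝ] ℝ} {z : E}
  {A B : E →ₗ[ℝ] E}

theorem orthogonal_of_skew_of_map_eq_zero (hA : ∀ v w, g (A v) w + g v (A w) = 0) (hAz : A z = 0)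
    (hsymm : ∀ v w, g v w = g w v) (v : E) : g z (A v) = 0 := by
  have := hA v z
  rw [hAz, map_zero, add_zero] at this
  rw [hsymm, this]

/-- If `A x ≠ 0` for an infinitesimal rotation `A`, then `A` is injective on the plane spanned by
`x` and `A x`. -/
theorem skew_injective_on_plane (hsymm : ∀ v w, g v w = g w v)
    (hpos : ∀ w, g z w = 0 → w ≠ 0 → 0 < g w w)
    (hA : ∀ v w, g (A v) w + g v (A w) = 0) (hAz : A z = 0) {x : E} (hx : A x ≠ 0) {a b : ℝ}
    (h : A (a • x + b • A x) = 0) : a = 0 ∧ b = 0 := by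
  have hy : 0 < g (A x) (A x) := hpos _ (orthogonal_of_skew_of_map_eq_zero hA hAz hsymm x) hx
  have hxx : g (A x) x = 0 := by linarith [hA x x, hsymm x (A x)]
  have h1 : b = 0 := by
    have e := congrArg (fun v ↦ g v x) h
    simp only [map_add, map_smul, LinearMap.add_apply, LinearMap.smul_apply, smul_eq_mul, map_zero,
      LinearMap.zero_apply, hxx, mul_zero, zero_add] at e
    have e2 := hA (A x) x
    have : b * g (A x) (A x) = 0 := by linear_combination -e + b * e2
    exact (mul_eq_zero.1 this).resolve_right hy.ne'
  refine ⟨?_, h1⟩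
  rw [h1, zero_smul, add_zero, map_smul] at h
  exact (smul_eq_zero.1 h).resolve_right hx

/-- In dimension four, commuting infinitesimal rotations about the same timelike axis are
proportional (the Lie algebra `so(3)` has rank one). -/
theorem commuting_skew_proportional (hdim : Module.finrank ℝ E = 4)
    (hsymm : ∀ v w, g v w = g w v) (hz : g z z < 0)
    (hpos : ∀ w, g z w = 0 → w ≠ 0 → 0 < g w w)
    (hA : ∀ v w, g (A v) w + g v (A w) = 0) (hAz : A z = 0)
    (hB : ∀ v w, g (B v) w + g v (B w) = 0) (hBz : B z = 0)
    (hAB : ∀ v, A (B v) = B (A v)) (hA0 : A ≠ 0) : ∃ t : ℝ, B = t • A := by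
  have : FiniteDimensional ℝ E := Module.finite_of_finrank_pos (by omega)
  obtain ⟨x₀, hx₀⟩ : ∃ x, A x ≠ 0 := by
    by_contra! h
    exact hA0 (LinearMap.ext h)
  obtain ⟨x, hAx, hzx⟩ : ∃ x, A x ≠ 0 ∧ g z x = 0 := by
    refine ⟨x₀ - (g z x₀ / g z z) • z, by simpa [hAz] using hx₀, ?_⟩
    simp [hz.ne]
  have hAA := orthogonal_of_skew_of_map_eq_zero hA hAz hsymm
  have hx0 : x ≠ 0 := by rintro rfl; simp at hAx
  have hX : 0 < g x x := hpos x hzx hx0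
  have hY : 0 < g (A x) (A x) := hpos _ (hAA x) hAx
  have hxy : g x (A x) = 0 := by linarith [hA x x, hsymm x (A x)]
  obtain ⟨k, hk0, hzk, hxk, hyk⟩ : ∃ k ≠ 0, g z k = 0 ∧ g x k = 0 ∧ g (A x) k = 0 := by
    have := LinearMap.ker_ne_bot_of_finrank_lt
      (f := (g z).prod ((g x).prod (g (A x)))) (by simp [hdim])
    obtain ⟨k, hk, hk0⟩ := (Submodule.ne_bot_iff _).1 this
    simp [LinearMap.mem_ker] at hk
    exact ⟨k, hk0, hk.1, hk.2.1, hk.2.2⟩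
  have hK : 0 < g k k := hpos k hzk hk0
  -- `z, x, A x, k` is an orthogonal basis
  have hbasis : ∀ v, g z v = 0 → g x v = 0 → g (A x) v = 0 → g k v = 0 → v = 0 := by
    let Φ : E →ₗ[ℝ] ℝ × ℝ × ℝ × ℝ := (g z).prod ((g x).prod ((g (A x)).prod (g k)))
    have hsurj : Function.Surjective Φ := by
      rintro ⟨a, b, c, d⟩
      refine ⟨(a / g z z) • z + (b / g x x) • x + (c / g (A x) (A x)) • A x + (d / g k k) • k, ?_⟩
      have e1 := hsymm x z; have e2 := hsymm (A x) z; have e3 := hsymm k z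
      have e4 := hsymm (A x) x; have e5 := hsymm k x; have e6 := hsymm k (A x)
      simp [Φ, hz.ne, hX.ne', hY.ne', hK.ne', hzx, hzk, hxk, hyk, hxy, hAA, e1, e2, e3, e4, e5, e6]
    have hinj := (LinearMap.injective_iff_surjective_of_finrank_eq_finrank
      (by simp [hdim])).2 hsurj
    intro v h1 h2 h3 h4
    exact hinj (by simp [Φ, h1, h2, h3, h4])
  set t : ℝ := g (A x) (B x) / g (A x) (A x) with ht
  refine ⟨t, ?_⟩
  -- `C = B - t A` is again a rotation commuting with `A`, and `g (C x) (A x) = 0`.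
  set C : E →ₗ[ℝ] E := B - t • A with hC
  have hCs : ∀ v w, g (C v) w + g v (C w) = 0 := by
    intro v w
    simp only [hC, LinearMap.sub_apply, LinearMap.smul_apply, map_sub, map_smul, smul_eq_mul]
    linear_combination hB v w - t * hA v w
  have hCz : C z = 0 := by simp [hC, hAz, hBz]
  have hAC : ∀ v, A (C v) = C (A v) := by intro v; simp [hC, hAB]
  have hCC := orthogonal_of_skew_of_map_eq_zero hCs hCz hsymm
  have hCself : ∀ v, g v (C v) = 0 := fun v ↦ by linarith [hCs v v, hsymm v (C v)]
  have hAself : ∀ v, g v (A v) = 0 := fun v ↦ by linarith [hA v v, hsymm v (A v)]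
  have hCxy : g (A x) (C x) = 0 := by
    simp only [hC, LinearMap.sub_apply, LinearMap.smul_apply, map_sub, map_smul, smul_eq_mul, ht]
    field_simp
    ring
  have hxCy : g x (C (A x)) = 0 := by linarith [hCs x (A x), hsymm (C x) (A x)]
  -- `C x` is proportional to `k`
  set l : ℝ := g k (C x) / g k k with hl
  have hCx : C x = l • k := by
    rw [← sub_eq_zero]
    apply hbasis
    · simp [hCC, hzk]
    · simp [hCself, hxk]
    · simp [hCxy, hyk]
    · simp [hl, hK.ne']
  have hCk : C k = (-(l * g k k) / g x x) • x := by
    rw [← sub_eq_zero]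
    apply hbasis
    · simp [hCC, hzx]
    · have := hCs x k
      rw [hCx] at this
      simp [hX.ne'] at this ⊢
      linarith
    · have h1 := hCs (A x) k
      rw [← hAC, hCx, map_smul, map_smul, LinearMap.smul_apply, hsymm (A k) k, hAself] at h1
      simp only [smul_zero, zero_add] at h1
      simp [h1, hsymm (A x) x, hxy]
    · simp [hCself, hsymm k x, hxk]
  have hCy : C (A x) = 0 := by
    apply hbasis
    · exact hCC _
    · exact hxCy
    · exact hCself _
    · rw [← hAC, hCx, map_smul, map_smul, hAself, smul_zero]
  have hl0 : l = 0 := by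
    by_contra hl0
    have hAk : A k = 0 := by
      have := hAC x
      rw [hCy, hCx, map_smul] at this
      exact (smul_eq_zero.1 this).resolve_left hl0
    have := hAC k
    rw [hAk, map_zero, hCk, map_smul] at this
    rcases smul_eq_zero.1 this with h | h
    · rw [div_eq_zero_iff] at h
      rcases h with h | h
      · rw [neg_eq_zero] at h
        exact (mul_ne_zero hl0 hK.ne') h
      · exact hX.ne' h
    · exact hAx h
  rw [hl0, zero_smul] at hCx
  have hCk0 : C k = 0 := by rw [hCk, hl0]; simp
  have : C = 0 := by
    ext v
    refine hbasis _ (hCC v) ?_ ?_ ?_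
    · have := hCs x v; rw [hCx] at this; simpa using this
    · have := hCs (A x) v; rw [hCy] at this; simpa using this
    · have := hCs k v; rw [hCk0] at this; simpa using this
  rwa [hC, sub_eq_zero] at this

end Rotation

/-! ### Commuting Killing fields in a chart -/

section Chart

variable {E : Type*} [NormedAddCommGroup E] [NormedSpace ℝ E]
  {G : E → E →L[ℝ] E →L[ℝ] ℝ} {K L M : E → E} {x : E}

/-- The exterior derivative `dω(v, w)` at `x` of the 1-form `ω = G(K, ·)` on a vector space,
evaluated on constant vector fields. -/
noncomputable def dFlat (G : E → E →L[ℝ] E →L[ℝ] ℝ) (K : E → E) (x v w : E) : ℝ :=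
  fderiv ℝ G x v (K x) w + G x (fderiv ℝ K x v) w
    - (fderiv ℝ G x w (K x) v + G x (fderiv ℝ K x w) v)

theorem hasFDerivAt_metric (hG : DifferentiableAt ℝ G x) (hK : DifferentiableAt ℝ K x)
    (hL : DifferentiableAt ℝ L x) :
    ∃ f' : E →L[ℝ] ℝ, HasFDerivAt (fun y ↦ G y (K y) (L y)) f' x ∧ ∀ v, f' v =
      fderiv ℝ G x v (K x) (L x) + G x (fderiv ℝ K x v) (L x) + G x (K x) (fderiv ℝ L x v) := by
  refine ⟨_, (hG.hasFDerivAt.clm_apply hK.hasFDerivAt).clm_apply hL.hasFDerivAt, fun v ↦ ?_⟩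
  simp
  ring

theorem fderiv_metric (hG : DifferentiableAt ℝ G x) (hK : DifferentiableAt ℝ K x)
    (hL : DifferentiableAt ℝ L x) (v : E) :
    fderiv ℝ (fun y ↦ G y (K y) (L y)) x v =
      fderiv ℝ G x v (K x) (L x) + G x (fderiv ℝ K x v) (L x) + G x (K x) (fderiv ℝ L x v) := by
  obtain ⟨f', h, h'⟩ := hasFDerivAt_metric hG hK hL
  rw [h.fderiv, h']

/-- Cartan's formula: since `L` preserves `G` and `K`, it preserves `ω = G(K, ·)`, so
`d(ω(L)) = -i_L dω`. -/
theorem fderiv_metric_eq_dFlat (hG : DifferentiableAt ℝ G x) (hK : DifferentiableAt ℝ K x)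
    (hL : DifferentiableAt ℝ L x) (hLk : IsKillingAt G L x)
    (hKL : fderiv ℝ K x (L x) = fderiv ℝ L x (K x)) (v : E) :
    fderiv ℝ (fun y ↦ G y (K y) (L y)) x v = dFlat G K x v (L x) := by
  rw [fderiv_metric hG hK hL, dFlat, hKL]
  linear_combination hLk (K x) v

theorem fderiv_metric_killing (hG : DifferentiableAt ℝ G x) (hK : DifferentiableAt ℝ K x)
    (hL : DifferentiableAt ℝ L x) (hMk : IsKillingAt G M x)
    (hKM : fderiv ℝ K x (M x) = fderiv ℝ M x (K x))
    (hLM : fderiv ℝ L x (M x) = fderiv ℝ M x (L x)) :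
    fderiv ℝ (fun y ↦ G y (K y) (L y)) x (M x) = 0 := by
  rw [fderiv_metric hG hK hL, hKM, hLM]
  exact hMk _ _

theorem dFlat_add_right (v w₁ w₂ : E) :
    dFlat G K x v (w₁ + w₂) = dFlat G K x v w₁ + dFlat G K x v w₂ := by
  simp [dFlat]; ring

theorem dFlat_smul_right (c : ℝ) (v w : E) :
    dFlat G K x v (c • w) = c * dFlat G K x v w := by
  simp [dFlat]; ring

theorem dFlat_swap (v w : E) : dFlat G K x v w = -dFlat G K x w v := by
  simp [dFlat]

theorem IsKillingAt.sub_smul (hK : IsKillingAt G K x) (hL : IsKillingAt G L x)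
    (hKd : DifferentiableAt ℝ K x) (hLd : DifferentiableAt ℝ L x) (t : ℝ) :
    IsKillingAt G (K - t • L) x := by
  intro v w
  have h : fderiv ℝ (K - t • L) x = fderiv ℝ K x - t • fderiv ℝ L x := by
    rw [fderiv_sub hKd (hLd.const_smul t), fderiv_const_smul hLd]
  simp only [h, Pi.sub_apply, Pi.smul_apply, map_sub, map_smul, sub_apply,
    smul_apply, smul_eq_mul]
  linear_combination hK v w - t * hL v w

/-- Three commuting Killing fields `X 0`, `X 1`, `X 2` of a Lorentzian metric `G` on an open subset
`Ω` of a vector space, such that `X 2` is timelike, the orbits of `X 0`, `X 1` are spacelike and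
two-dimensional on a dense set, and the orthogonal complements of the two-dimensional orbits form
an integrable distribution. -/
structure OrthTransitiveTriple (Ω : Set E) (G : E → E →L[ℝ] E →L[ℝ] ℝ) (X : Fin 3 → E → E) :
    Prop where
  isOpen : IsOpen Ω
  smooth_metric : ∀ x ∈ Ω, ContDiffAt ℝ ∞ G x
  symm : ∀ x ∈ Ω, ∀ v w, G x v w = G x w v
  lorentz : ∀ x ∈ Ω, ∀ z w, G x z z < 0 → G x z w = 0 → w ≠ 0 → 0 < G x w w
  smooth : ∀ i, ∀ x ∈ Ω, ContDiffAt ℝ ∞ (X i) x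
  killing : ∀ i, ∀ x ∈ Ω, IsKillingAt G (X i) x
  comm : ∀ i j, ∀ x ∈ Ω, fderiv ℝ (X i) x (X j x) = fderiv ℝ (X j) x (X i x)
  timelike : ∀ x ∈ Ω, G x (X 2 x) (X 2 x) < 0
  spacelike : ∀ x ∈ Ω, ∀ a b : ℝ, a • X 0 x + b • X 1 x ≠ 0 →
    0 < G x (a • X 0 x + b • X 1 x) (a • X 0 x + b • X 1 x)
  dense : ∀ x ∈ Ω, ∃ᶠ y in 𝓝 x,
    G y (X 0 y) (X 0 y) * G y (X 1 y) (X 1 y) - G y (X 0 y) (X 1 y) ^ 2 ≠ 0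
  orth : ∀ x ∈ Ω, G x (X 0 x) (X 0 x) * G x (X 1 x) (X 1 x) - G x (X 0 x) (X 1 x) ^ 2 ≠ 0 →
    ∀ v w, G x (X 0 x) v = 0 → G x (X 1 x) v = 0 → G x (X 0 x) w = 0 → G x (X 1 x) w = 0 →
      dFlat G (X 0) x v w = 0 ∧ dFlat G (X 1) x v w = 0

/-- The scalar products of a family of vector fields. -/
noncomputable def gram (G : E → E →L[ℝ] E →L[ℝ] ℝ) (X : Fin 3 → E → E) (i j : Fin 3) (y : E) : ℝ :=
  G y (X i y) (X j y)

/-- The Gram determinant of `X 0` and `X 1`; it vanishes where their orbits degenerate. -/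
noncomputable def gramDet (G : E → E →L[ℝ] E →L[ℝ] ℝ) (X : Fin 3 → E → E) (y : E) : ℝ :=
  gram G X 0 0 y * gram G X 1 1 y - gram G X 0 1 y ^ 2

/-- The coefficients `(a, b)` of the orthogonal projection `a • X 0 + b • X 1` of `X 2` to the
orbits of `X 0` and `X 1`, by Cramer's rule (meaningful where `gramDet ≠ 0`). -/
noncomputable def projCoeff (G : E → E →L[ℝ] E →L[ℝ] ℝ) (X : Fin 3 → E → E) (y : E) : ℝ × ℝ :=
  ((gram G X 0 2 y * gram G X 1 1 y - gram G X 1 2 y * gram G X 0 1 y) / gramDet G X y,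
    (gram G X 0 0 y * gram G X 1 2 y - gram G X 0 1 y * gram G X 0 2 y) / gramDet G X y)

variable {Ω : Set E} {X : Fin 3 → E → E}

theorem gram_eq_of_gramDet_ne_zero {y : E} (h : gramDet G X y ≠ 0) :
    gram G X 0 2 y
        = (projCoeff G X y).1 * gram G X 0 0 y + (projCoeff G X y).2 * gram G X 0 1 y ∧
      gram G X 1 2 y
        = (projCoeff G X y).1 * gram G X 0 1 y + (projCoeff G X y).2 * gram G X 1 1 y := by
  simp only [projCoeff]
  constructor <;> · field_simp; simp only [gramDet]; ring

namespace OrthTransitiveTriple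

variable (T : OrthTransitiveTriple Ω G X)
include T

theorem differentiableAt_metric {x : E} (hx : x ∈ Ω) : DifferentiableAt ℝ G x :=
  (T.smooth_metric x hx).differentiableAt (by simp)

theorem differentiableAt (i : Fin 3) {x : E} (hx : x ∈ Ω) : DifferentiableAt ℝ (X i) x :=
  (T.smooth i x hx).differentiableAt (by simp)

theorem contDiffAt_gram (i j : Fin 3) {x : E} (hx : x ∈ Ω) : ContDiffAt ℝ ∞ (gram G X i j) x :=
  ((T.smooth_metric x hx).clm_apply (T.smooth i x hx)).clm_apply (T.smooth j x hx)

theorem differentiableAt_gram (i j : Fin 3) {x : E} (hx : x ∈ Ω) :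
    DifferentiableAt ℝ (gram G X i j) x :=
  (T.contDiffAt_gram i j hx).differentiableAt (by simp)

theorem differentiableAt_gramDet {x : E} (hx : x ∈ Ω) : DifferentiableAt ℝ (gramDet G X) x :=
  ((T.differentiableAt_gram 0 0 hx).mul (T.differentiableAt_gram 1 1 hx)).sub
    ((T.differentiableAt_gram 0 1 hx).pow 2)

theorem gram_symm (i j : Fin 3) {x : E} (hx : x ∈ Ω) : gram G X i j x = gram G X j i x :=
  T.symm x hx _ _

theorem fderiv_gram (i j : Fin 3) {x : E} (hx : x ∈ Ω) (v : E) :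
    fderiv ℝ (gram G X i j) x v = dFlat G (X i) x v (X j x) :=
  fderiv_metric_eq_dFlat (T.differentiableAt_metric hx) (T.differentiableAt i hx)
    (T.differentiableAt j hx) (T.killing j x hx) (T.comm i j x hx) v

theorem fderiv_gram_killing (i j k : Fin 3) {x : E} (hx : x ∈ Ω) :
    fderiv ℝ (gram G X i j) x (X k x) = 0 :=
  fderiv_metric_killing (T.differentiableAt_metric hx) (T.differentiableAt i hx)
    (T.differentiableAt j hx) (T.killing k x hx) (T.comm i k x hx) (T.comm j k x hx)

theorem fderiv_gram_symm (i j : Fin 3) {x : E} (hx : x ∈ Ω) :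
    fderiv ℝ (gram G X i j) x = fderiv ℝ (gram G X j i) x :=
  Filter.EventuallyEq.fderiv_eq ((T.isOpen.eventually_mem hx).mono fun _ hy ↦ T.gram_symm i j hy)

/-- Orthogonal transitivity annihilates the component of `X 2` orthogonal to the orbits in the
derivatives of the scalar products. -/
theorem fderiv_gram_two {x : E} (hx : x ∈ Ω) (hD : gramDet G X x ≠ 0) (v : E) :
    fderiv ℝ (gram G X 0 2) x v = (projCoeff G X x).1 * fderiv ℝ (gram G X 0 0) x v
        + (projCoeff G X x).2 * fderiv ℝ (gram G X 0 1) x v ∧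
      fderiv ℝ (gram G X 1 2) x v = (projCoeff G X x).1 * fderiv ℝ (gram G X 0 1) x v
        + (projCoeff G X x).2 * fderiv ℝ (gram G X 1 1) x v := by
  obtain ⟨h0, h1⟩ := gram_eq_of_gramDet_ne_zero hD
  set a := (projCoeff G X x).1
  set b := (projCoeff G X x).2
  have hs := T.symm x hx
  have hsymm : G x (X 1 x) (X 0 x) = G x (X 0 x) (X 1 x) := hs _ _
  -- `v = α X₀ + β X₁ + n` with `n` orthogonal to the orbit
  set α := (G x (X 0 x) v * gram G X 1 1 x - G x (X 1 x) v * gram G X 0 1 x) / gramDet G X x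
    with hα
  set β := (gram G X 0 0 x * G x (X 1 x) v - gram G X 0 1 x * G x (X 0 x) v) / gramDet G X x
    with hβ
  obtain ⟨n, hn⟩ : ∃ n, n = v - (α • X 0 x + β • X 1 x) := ⟨_, rfl⟩
  have hv : v = n + (α • X 0 x + β • X 1 x) := by rw [hn]; abel
  have hn0 : G x (X 0 x) n = 0 := by
    rw [hn]
    simp only [map_sub, map_add, map_smul, smul_eq_mul, hα, hβ]
    field_simp
    simp only [gramDet, gram]
    ring
  have hn1 : G x (X 1 x) n = 0 := by
    rw [hn]
    simp only [map_sub, map_add, map_smul, smul_eq_mul, hα, hβ]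
    field_simp
    simp only [gramDet, gram, hsymm]
    ring
  have hred : ∀ i j, fderiv ℝ (gram G X i j) x v = fderiv ℝ (gram G X i j) x n := by
    intro i j
    rw [hv]
    simp [T.fderiv_gram_killing i j _ hx]
  simp only [hred]
  have hs0 : G x (X 0 x) (X 2 x + ((-a) • X 0 x + (-b) • X 1 x)) = 0 := by
    simp only [map_add, map_smul, smul_eq_mul]
    simp only [gram] at h0
    linarith
  have hs1 : G x (X 1 x) (X 2 x + ((-a) • X 0 x + (-b) • X 1 x)) = 0 := by
    simp only [map_add, map_smul, smul_eq_mul]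
    simp only [gram] at h1
    rw [hsymm]
    linarith
  obtain ⟨e0, e1⟩ := T.orth x hx hD n _ hn0 hn1 hs0 hs1
  simp only [dFlat_add_right, dFlat_smul_right, ← T.fderiv_gram _ _ hx] at e0 e1
  rw [T.fderiv_gram_symm 1 0 hx] at e1
  constructor <;> linarith

/-- The coefficients of the projection of `X 2` to the orbits are locally constant. -/
theorem eventually_projCoeff_eq {x : E} (hx : x ∈ Ω) (hD : gramDet G X x ≠ 0) :
    ∀ᶠ y in 𝓝 x, projCoeff G X y = projCoeff G X x := by
  have hev : ∀ᶠ y in 𝓝 x, y ∈ Ω ∧ gramDet G X y ≠ 0 :=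
    (T.isOpen.eventually_mem hx).and
      ((T.differentiableAt_gramDet hx).continuousAt.eventually_ne hD)
  have hdiff : ∀ y, y ∈ Ω → gramDet G X y ≠ 0 →
      DifferentiableAt ℝ (fun y ↦ (projCoeff G X y).1) y ∧
      DifferentiableAt ℝ (fun y ↦ (projCoeff G X y).2) y := by
    intro y hy hDy
    have hinv := (T.differentiableAt_gramDet hy).inv hDy
    simp only [projCoeff, div_eq_mul_inv]
    exact ⟨(((T.differentiableAt_gram 0 2 hy).mul (T.differentiableAt_gram 1 1 hy)).sub
      ((T.differentiableAt_gram 1 2 hy).mul (T.differentiableAt_gram 0 1 hy))).mul hinv,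
      (((T.differentiableAt_gram 0 0 hy).mul (T.differentiableAt_gram 1 2 hy)).sub
      ((T.differentiableAt_gram 0 1 hy).mul (T.differentiableAt_gram 0 2 hy))).mul hinv⟩
  have hzero : ∀ y, y ∈ Ω → gramDet G X y ≠ 0 →
      fderiv ℝ (fun y ↦ (projCoeff G X y).1) y = 0 ∧
      fderiv ℝ (fun y ↦ (projCoeff G X y).2) y = 0 := by
    intro y hy hDy
    obtain ⟨ha, hb⟩ := hdiff y hy hDy
    have hev' : ∀ᶠ z in 𝓝 y, gramDet G X z ≠ 0 :=
      (T.differentiableAt_gramDet hy).continuousAt.eventually_ne hDy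
    have k1 := ((ha.hasFDerivAt.mul (T.differentiableAt_gram 0 0 hy).hasFDerivAt).add
      (hb.hasFDerivAt.mul (T.differentiableAt_gram 0 1 hy).hasFDerivAt)).congr_of_eventuallyEq
      (hev'.mono fun z hz ↦ (gram_eq_of_gramDet_ne_zero hz).1)
    have k2 := ((ha.hasFDerivAt.mul (T.differentiableAt_gram 0 1 hy).hasFDerivAt).add
      (hb.hasFDerivAt.mul (T.differentiableAt_gram 1 1 hy).hasFDerivAt)).congr_of_eventuallyEq
      (hev'.mono fun z hz ↦ (gram_eq_of_gramDet_ne_zero hz).2)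
    have l : ∀ v, fderiv ℝ (fun y ↦ (projCoeff G X y).1) y v = 0 ∧
        fderiv ℝ (fun y ↦ (projCoeff G X y).2) y v = 0 := by
      intro v
      have e1 := congrArg (fun L : E →L[ℝ] ℝ ↦ L v) k1.fderiv
      have e2 := congrArg (fun L : E →L[ℝ] ℝ ↦ L v) k2.fderiv
      obtain ⟨f1, f2⟩ := T.fderiv_gram_two hy hDy v
      simp only [add_apply, smul_apply, smul_eq_mul]
        at e1 e2
      have g1 : gramDet G X y * fderiv ℝ (fun y ↦ (projCoeff G X y).1) y v = 0 := by
        simp only [gramDet]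
        linear_combination (gram G X 1 1 y) * (f1 - e1) - (gram G X 0 1 y) * (f2 - e2)
      have g2 : gramDet G X y * fderiv ℝ (fun y ↦ (projCoeff G X y).2) y v = 0 := by
        simp only [gramDet]
        linear_combination (gram G X 0 0 y) * (f2 - e2) - (gram G X 0 1 y) * (f1 - e1)
      exact ⟨(mul_eq_zero.1 g1).resolve_left hDy, (mul_eq_zero.1 g2).resolve_left hDy⟩
    exact ⟨ContinuousLinearMap.ext fun v ↦ (l v).1, ContinuousLinearMap.ext fun v ↦ (l v).2⟩
  obtain ⟨R, hR, hball⟩ := Metric.eventually_nhds_iff_ball.1 hev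
  filter_upwards [Metric.ball_mem_nhds x hR] with y hy
  have hc := convex_ball x R
  have hw : ∀ z ∈ Metric.ball x R, fderivWithin ℝ (fun y ↦ (projCoeff G X y).1)
      (Metric.ball x R) z = 0 ∧ fderivWithin ℝ (fun y ↦ (projCoeff G X y).2)
      (Metric.ball x R) z = 0 := by
    intro z hz
    rw [fderivWithin_of_isOpen Metric.isOpen_ball hz, fderivWithin_of_isOpen Metric.isOpen_ball hz]
    exact hzero z (hball z hz).1 (hball z hz).2
  refine Prod.ext ?_ ?_
  · exact hc.is_const_of_fderivWithin_eq_zero (𝕜 := ℝ) (f := fun y ↦ (projCoeff G X y).1)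
      (fun z hz ↦ (hdiff z (hball z hz).1 (hball z hz).2).1.differentiableWithinAt)
      (fun z hz ↦ (hw z hz).1) hy (Metric.mem_ball_self hR)
  · exact hc.is_const_of_fderivWithin_eq_zero (𝕜 := ℝ) (f := fun y ↦ (projCoeff G X y).2)
      (fun z hz ↦ (hdiff z (hball z hz).1 (hball z hz).2).2.differentiableWithinAt)
      (fun z hz ↦ (hw z hz).2) hy (Metric.mem_ball_self hR)

theorem nondegenerate {x : E} (hx : x ∈ Ω) (v : E) (hv : G x v = 0) : v = 0 := by
  by_contra h
  have := T.lorentz x hx (X 2 x) v (T.timelike x hx) (by rw [T.symm x hx, hv]; rfl) h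
  rw [hv] at this
  simp at this

theorem fderiv_skew {i : Fin 3} {x : E} (hx : x ∈ Ω) (h : X i x = 0) (v w : E) :
    G x (fderiv ℝ (X i) x v) w + G x v (fderiv ℝ (X i) x w) = 0 := by
  have := T.killing i x hx v w
  simpa [h] using this

theorem fderiv_eq_zero_of_comm {i : Fin 3} (j : Fin 3) {x : E} (hx : x ∈ Ω) (h : X i x = 0) :
    fderiv ℝ (X i) x (X j x) = 0 := by
  rw [T.comm i j x hx, h, map_zero]

/-- Where the orbits degenerate, `X 0` equals its projection to `X 1`. -/
theorem sub_smul_eq_zero_of_gramDet_eq_zero {x : E} (hx : x ∈ Ω) (hD : gramDet G X x = 0)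
    (hr : gram G X 1 1 x ≠ 0) : X 0 x - (gram G X 0 1 x / gram G X 1 1 x) • X 1 x = 0 := by
  by_contra hne
  have h1 : X 0 x - (gram G X 0 1 x / gram G X 1 1 x) • X 1 x
      = (1 : ℝ) • X 0 x + (-(gram G X 0 1 x / gram G X 1 1 x)) • X 1 x := by module
  rw [h1] at hne
  have := T.spacelike x hx _ _ hne
  have hsymm : G x (X 1 x) (X 0 x) = G x (X 0 x) (X 1 x) := T.symm x hx _ _
  simp only [map_add, map_smul, add_apply, smul_apply,
    smul_eq_mul, hsymm] at this
  simp only [gramDet, gram] at hD hr this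
  have e : G x (X 0 x) (X 0 x) = G x (X 0 x) (X 1 x) ^ 2 / G x (X 1 x) (X 1 x) := by
    rw [eq_div_iff hr]; linarith
  rw [e] at this
  apply this.ne'
  field_simp
  ring

variable [FiniteDimensional ℝ E]

/-- By density of the two-dimensional orbits, no nontrivial combination of `X 0` and `X 1` has
vanishing 1-jet at a point. -/
theorem fderiv_ne_zero {x : E} (hx : x ∈ Ω) (h : X 0 x = 0) : fderiv ℝ (X 0) x ≠ 0 := by
  intro h1
  have := IsKillingAt.eventually_eq_zero (T.smooth_metric x hx) (T.smooth 0 x hx)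
    ((T.isOpen.eventually_mem hx).mono fun y hy ↦ T.killing 0 y hy)
    ((T.isOpen.eventually_mem hx).mono fun y hy ↦ T.symm y hy) (T.nondegenerate hx) h h1
  exact T.dense x hx (this.mono fun y hy ↦ by simp [hy])

/-- No orbit of `X 0` and `X 1` is a point: their linearizations at a common zero would be
commuting rotations about the axis `X 2`. -/
theorem ne_zero_of_eq_zero (hdim : Module.finrank ℝ E = 4) {x : E} (hx : x ∈ Ω) (h : X 0 x = 0) :
    X 1 x ≠ 0 := by
  intro h'
  have hcomm : ∀ v, fderiv ℝ (X 0) x (fderiv ℝ (X 1) x v)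
      = fderiv ℝ (X 1) x (fderiv ℝ (X 0) x v) := by
    have c2 : ∀ i, ContDiffAt ℝ 2 (X i) x := fun i ↦ (T.smooth i x hx).of_le ENat.LEInfty.out
    have d2 : ∀ i, HasFDerivAt (fderiv ℝ (X i)) (fderiv ℝ (fderiv ℝ (X i)) x) x := fun i ↦
      (((c2 i).fderiv_right (m := 1) (by norm_num)).differentiableAt (by simp)).hasFDerivAt
    have k1 := (d2 0).clm_apply (T.differentiableAt 1 hx).hasFDerivAt
    have k2 := (d2 1).clm_apply (T.differentiableAt 0 hx).hasFDerivAt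
    have k3 := k2.congr_of_eventuallyEq
      ((T.isOpen.eventually_mem hx).mono fun y hy ↦ T.comm 0 1 y hy)
    intro v
    have := congrArg (fun L : E →L[ℝ] E ↦ L v) (k1.unique k3)
    simpa [h, h'] using this
  obtain ⟨t, ht⟩ := commuting_skew_proportional (g := (G x).toLinearMap₁₂) (z := X 2 x)
    (A := (fderiv ℝ (X 0) x).toLinearMap) (B := (fderiv ℝ (X 1) x).toLinearMap) hdim
    (T.symm x hx) (T.timelike x hx) (fun w ↦ T.lorentz x hx _ w (T.timelike x hx))
    (T.fderiv_skew hx h) (T.fderiv_eq_zero_of_comm 2 hx h)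
    (T.fderiv_skew hx h') (T.fderiv_eq_zero_of_comm 2 hx h') hcomm
    (fun h0 ↦ T.fderiv_ne_zero hx h (ContinuousLinearMap.coe_injective h0))
  have hev := IsKillingAt.eventually_eq_zero (X := X 1 - t • X 0) (T.smooth_metric x hx)
    ((T.smooth 1 x hx).sub ((T.smooth 0 x hx).const_smul t))
    ((T.isOpen.eventually_mem hx).mono fun y hy ↦
      (T.killing 1 y hy).sub_smul (T.killing 0 y hy) (T.differentiableAt 1 hy)
        (T.differentiableAt 0 hy) t)
    ((T.isOpen.eventually_mem hx).mono fun y hy ↦ T.symm y hy) (T.nondegenerate hx)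
    (by simp [h, h'])
    (by
      rw [fderiv_sub (T.differentiableAt 1 hx) ((T.differentiableAt 0 hx).const_smul t),
        fderiv_const_smul (T.differentiableAt 0 hx), sub_eq_zero]
      exact ContinuousLinearMap.coe_injective ht)
  refine T.dense x hx (hev.mono fun y hy ↦ ?_)
  have : X 1 y = t • X 0 y := by simpa [sub_eq_zero] using hy
  simp [this]
  ring

/-- Near a zero of `X 0`, which is not a zero of `X 1`, the coefficients of the projection of
`X 2` to the orbits take only one value. The degenerate orbits lie in the zero set of
`X 0 - (q / r) • X 1`, whose derivative at the given point is an infinitesimal rotation `A`; so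
they meet the slices parallel to a plane on which `A` is injective at most once. -/
theorem exists_eventually_projCoeff_of_eq_zero (hdim : Module.finrank ℝ E = 4) {x₀ : E}
    (hx₀ : x₀ ∈ Ω) (h0 : X 0 x₀ = 0) :
    ∃ c, ∀ᶠ y in 𝓝 x₀, gramDet G X y ≠ 0 → projCoeff G X y = c := by
  have h1 := T.ne_zero_of_eq_zero hdim hx₀ h0
  have hr : 0 < gram G X 1 1 x₀ := by
    simpa [gram] using T.spacelike x₀ hx₀ 0 1 (by simpa using h1)
  set A := fderiv ℝ (X 0) x₀ with hA
  have hA0 : A ≠ 0 := T.fderiv_ne_zero hx₀ h0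
  obtain ⟨e, he⟩ : ∃ e, A e ≠ 0 := by
    by_contra! h
    exact hA0 (ContinuousLinearMap.ext h)
  have hinj : ∀ a b : ℝ, A (a • e + b • A e) = 0 → a = 0 ∧ b = 0 := fun a b hab ↦
    skew_injective_on_plane (g := (G x₀).toLinearMap₁₂) (z := X 2 x₀) (A := A.toLinearMap)
      (T.symm x₀ hx₀) (fun w ↦ T.lorentz x₀ hx₀ _ w (T.timelike x₀ hx₀))
      (T.fderiv_skew hx₀ h0) (T.fderiv_eq_zero_of_comm 2 hx₀ h0) he hab
  have hli : LinearIndependent ℝ ![e, A e] :=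
    LinearIndependent.pair_iff.2 fun a b hab ↦ hinj a b (by rw [hab, map_zero])
  let P : Submodule ℝ E := Submodule.span ℝ {e, A e}
  have hP1 : e ∈ P := Submodule.subset_span (by simp)
  have hP2 : A e ∈ P := Submodule.subset_span (by simp)
  obtain ⟨κ, hκ, hanti⟩ : ∃ κ > (0 : ℝ), ∀ v ∈ P, ‖v‖ ≤ κ * ‖A v‖ := by
    obtain ⟨κ, hκ, h⟩ := (A.toLinearMap.comp P.subtype).exists_antilipschitzWith
      (LinearMap.ker_eq_bot'.2 fun ⟨v, hv⟩ hv0 ↦ by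
        obtain ⟨a, b, rfl⟩ := Submodule.mem_span_pair.1 hv
        obtain ⟨rfl, rfl⟩ := hinj a b hv0
        simp)
    exact ⟨κ, hκ, fun v hv ↦ by simpa using h.le_mul_norm_sub (x := ⟨v, hv⟩) (y := 0)⟩
  set F : E → E := fun y ↦ X 0 y - (gram G X 0 1 y / gram G X 1 1 y) • X 1 y with hF
  have hFs : ContDiffAt ℝ ∞ F x₀ := (T.smooth 0 x₀ hx₀).sub
    (((T.contDiffAt_gram 0 1 hx₀).div (T.contDiffAt_gram 1 1 hx₀) hr.ne').smul (T.smooth 1 x₀ hx₀))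
  have hFA : HasFDerivAt F A x₀ := by
    have hq0 : gram G X 0 1 x₀ = 0 := by simp [gram, h0]
    have hq : HasFDerivAt (gram G X 0 1) (0 : E →L[ℝ] ℝ) x₀ := by
      have : fderiv ℝ (gram G X 0 1) x₀ = 0 := by
        ext v
        have e1 := fderiv_metric (T.differentiableAt_metric hx₀) (T.differentiableAt 0 hx₀)
          (T.differentiableAt 1 hx₀) v
        have e2 := T.fderiv_skew hx₀ h0 v (X 1 x₀)
        rw [T.fderiv_eq_zero_of_comm 1 hx₀ h0] at e2
        simp only [h0, map_zero, zero_apply, zero_add, add_zero] at e1 e2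
        exact e1.trans e2
      rw [← this]
      exact (T.differentiableAt_gram 0 1 hx₀).hasFDerivAt
    have hi : DifferentiableAt ℝ (fun y ↦ (gram G X 1 1 y)⁻¹) x₀ :=
      (T.differentiableAt_gram 1 1 hx₀).inv hr.ne'
    have := (T.differentiableAt 0 hx₀).hasFDerivAt.sub
      ((hq.mul hi.hasFDerivAt).smul (T.differentiableAt 1 hx₀).hasFDerivAt)
    simp only [div_eq_mul_inv, hF]
    refine this.congr_fderiv ?_
    ext v
    simp [hq0, hA]
  have hstrict : HasStrictFDerivAt F A x₀ := hFs.hasStrictFDerivAt' hFA (by simp)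
  obtain ⟨s, hs, happ⟩ := hstrict.approximates_deriv_on_nhds
    (c := Real.toNNReal (1 / (2 * κ))) (Or.inr (Real.toNNReal_pos.2 (by positivity)))
  have hev : ∀ᶠ y in 𝓝 x₀, y ∈ s ∧ y ∈ Ω ∧ gram G X 1 1 y ≠ 0 :=
    Filter.Eventually.and hs ((T.isOpen.eventually_mem hx₀).and
      ((T.differentiableAt_gram 1 1 hx₀).continuousAt.eventually_ne hr.ne'))
  obtain ⟨R, hR, hball⟩ := Metric.eventually_nhds_iff_ball.1 hev
  set B := Metric.ball x₀ R with hB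
  have hZ : ∀ x ∈ B ∩ {y | gramDet G X y = 0}, ∀ y ∈ B ∩ {y | gramDet G X y = 0},
      y - x ∈ P → x = y := by
    rintro x ⟨hxB, hxD⟩ y ⟨hyB, hyD⟩ hxy
    obtain ⟨hxs, hxΩ, hxr⟩ := hball x hxB
    obtain ⟨hys, hyΩ, hyr⟩ := hball y hyB
    have hFx : F x = 0 := T.sub_smul_eq_zero_of_gramDet_eq_zero hxΩ hxD hxr
    have hFy : F y = 0 := T.sub_smul_eq_zero_of_gramDet_eq_zero hyΩ hyD hyr
    have e1 := happ y hys x hxs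
    rw [Real.coe_toNNReal _ (by positivity)] at e1
    rw [hFx, hFy, sub_zero, zero_sub, norm_neg] at e1
    have e2 := hanti _ hxy
    have e3 : ‖y - x‖ ≤ 1 / 2 * ‖y - x‖ := by
      calc ‖y - x‖ ≤ κ * ‖A (y - x)‖ := e2
        _ ≤ κ * (1 / (2 * κ) * ‖y - x‖) := by gcongr
        _ = 1 / 2 * ‖y - x‖ := by field_simp
    have e4 : ‖y - x‖ = 0 := by linarith [norm_nonneg (y - x)]
    exact (sub_eq_zero.1 (norm_eq_zero.1 e4)).symm
  have hBZ : IsOpen (B \ {y | gramDet G X y = 0}) := by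
    rw [isOpen_iff_eventually]
    rintro y ⟨hyB, hyD⟩
    filter_upwards [Metric.isOpen_ball.eventually_mem hyB,
      (T.differentiableAt_gramDet (hball y hyB).2.1).continuousAt.eventually_ne hyD] with z hz hz'
    exact ⟨hz, hz'⟩
  obtain ⟨y₀, hy₀, hy₀'⟩ := ((T.dense x₀ hx₀).and_eventually (Metric.ball_mem_nhds x₀ hR)).exists
  refine ⟨projCoeff G X y₀, ?_⟩
  filter_upwards [Metric.ball_mem_nhds x₀ hR] with y hy hyD
  exact eq_of_forall_slice_subsingleton Metric.isOpen_ball (convex_ball x₀ R) hli hP1 hP2 hZ hBZ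
    (fun z hz ↦ T.eventually_projCoeff_eq (hball z hz.1).2.1 hz.2) ⟨hy, hyD⟩ ⟨hy₀', hy₀⟩

/-- The timelike field differs locally by a constant combination of `X 0` and `X 1` from a field
orthogonal to their orbits. -/
theorem exists_eventually_orthogonal (hdim : Module.finrank ℝ E = 4) {x₀ : E} (hx₀ : x₀ ∈ Ω)
    (h0 : gramDet G X x₀ ≠ 0 ∨ X 0 x₀ = 0) :
    ∃ a b : ℝ, ∀ᶠ y in 𝓝 x₀, G y (X 2 y - (a • X 0 y + b • X 1 y)) (X 0 y) = 0 ∧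
      G y (X 2 y - (a • X 0 y + b • X 1 y)) (X 1 y) = 0 := by
  obtain ⟨c, hc⟩ : ∃ c, ∀ᶠ y in 𝓝 x₀, gramDet G X y ≠ 0 → projCoeff G X y = c := by
    rcases h0 with h0 | h0
    · exact ⟨_, (T.eventually_projCoeff_eq hx₀ h0).mono fun _ h _ ↦ h⟩
    · exact T.exists_eventually_projCoeff_of_eq_zero hdim hx₀ h0
  refine ⟨c.1, c.2, ?_⟩
  filter_upwards [hc.eventually_nhds, T.isOpen.eventually_mem hx₀] with y hy hyΩ
  have key : gram G X 0 2 y - (c.1 * gram G X 0 0 y + c.2 * gram G X 0 1 y) = 0 ∧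
      gram G X 1 2 y - (c.1 * gram G X 0 1 y + c.2 * gram G X 1 1 y) = 0 := by
    have hcont : ∀ i j, ContinuousAt (gram G X i j) y := fun i j ↦
      (T.differentiableAt_gram i j hyΩ).continuousAt
    have c1 := (hcont 0 2).sub (((hcont 0 0).const_mul c.1).add ((hcont 0 1).const_mul c.2))
    have c2 := (hcont 1 2).sub (((hcont 0 1).const_mul c.1).add ((hcont 1 1).const_mul c.2))
    constructor
    · by_contra h
      obtain ⟨z, hz, hz', hz''⟩ := ((T.dense y hyΩ).and_eventually
        (hy.and (c1.eventually_ne h))).exists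
      apply hz''
      rw [← hz' hz]
      exact sub_eq_zero.2 (gram_eq_of_gramDet_ne_zero hz).1
    · by_contra h
      obtain ⟨z, hz, hz', hz''⟩ := ((T.dense y hyΩ).and_eventually
        (hy.and (c2.eventually_ne h))).exists
      apply hz''
      rw [← hz' hz]
      exact sub_eq_zero.2 (gram_eq_of_gramDet_ne_zero hz).2
  have hs := T.symm y hyΩ
  simp only [gram] at key
  simp only [map_sub, map_add, map_smul, sub_apply,
    add_apply, smul_apply, smul_eq_mul]
  rw [hs (X 2 y) (X 0 y), hs (X 2 y) (X 1 y), hs (X 1 y) (X 0 y)]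
  exact key

end OrthTransitiveTriple

end Chart

/-! ### Fields and metric in a chart -/

section Transfer

variable {V : Type*} [TopologicalSpace V] [ChartedSpace (EuclideanSpace ℝ (Fin 4)) V]

/-- The expression of the vector field `X` in the chart at `p`. -/
noncomputable def chartField (p : V) (X : VecField V) :
    EuclideanSpace ℝ (Fin 4) → EuclideanSpace ℝ (Fin 4) :=
  fun x ↦ VectorField.mpullback 𝓘(ℝ, EuclideanSpace ℝ (Fin 4)) (𝓡 4)
    (extChartAt (𝓡 4) p).symm X x

/-- The vector field on the domain of the chart at `p` which is constantly `v` in this chart. -/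
noncomputable def coordField (p : V) (v : EuclideanSpace ℝ (Fin 4)) : VecField V :=
  VectorField.mpullback (𝓡 4) 𝓘(ℝ, EuclideanSpace ℝ (Fin 4)) (extChartAt (𝓡 4) p) (fun _ ↦ v)

/-- The derivative of the inverse of the chart at `p`. -/
noncomputable def chartSymmDeriv (p : V) (x : EuclideanSpace ℝ (Fin 4)) :
    EuclideanSpace ℝ (Fin 4) →L[ℝ] EuclideanSpace ℝ (Fin 4) :=
  mfderiv 𝓘(ℝ, EuclideanSpace ℝ (Fin 4)) (𝓡 4) (extChartAt (𝓡 4) p).symm x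

variable [IsManifold (𝓡 4) ∞ V]

instance : IsManifold (𝓡 4) 1 V := IsManifold.of_le (n := ∞) ENat.LEInfty.out
instance : IsManifold (𝓡 4) (minSmoothness ℝ 3) V := by
  rw [minSmoothness_of_isRCLikeNormedField]
  exact IsManifold.of_le (n := ∞) ENat.LEInfty.out

/-- The scalar product on the tangent space at `q`, as a bilinear form on the model space. -/
noncomputable def modelMetric (g : LorentzianMetric V) (q : V) :
    EuclideanSpace ℝ (Fin 4) →L[ℝ] EuclideanSpace ℝ (Fin 4) →L[ℝ] ℝ :=
  g.val q

/-- The expression of the metric in the chart at `p`. -/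
noncomputable def chartMetric (g : LorentzianMetric V) (p : V) (x : EuclideanSpace ℝ (Fin 4)) :
    EuclideanSpace ℝ (Fin 4) →L[ℝ] EuclideanSpace ℝ (Fin 4) →L[ℝ] ℝ :=
  (modelMetric g ((extChartAt (𝓡 4) p).symm x)).bilinearComp (chartSymmDeriv p x) (chartSymmDeriv p x)

theorem chartMetric_apply (g : LorentzianMetric V) (p : V) (x v w : EuclideanSpace ℝ (Fin 4)) :
    chartMetric g p x v w =
      g.val ((extChartAt (𝓡 4) p).symm x) (chartSymmDeriv p x v) (chartSymmDeriv p x w) := rfl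

variable {p : V} {x : EuclideanSpace ℝ (Fin 4)}

theorem contMDiffAt_chart_symm (hx : x ∈ (extChartAt (𝓡 4) p).target) :
    ContMDiffAt 𝓘(ℝ, EuclideanSpace ℝ (Fin 4)) (𝓡 4) ∞ (extChartAt (𝓡 4) p).symm x :=
  (contMDiffOn_extChartAt_symm p).contMDiffAt ((isOpen_extChartAt_target p).mem_nhds hx)

theorem isInvertible_chart_symm (hx : x ∈ (extChartAt (𝓡 4) p).target) :
    (mfderiv 𝓘(ℝ, EuclideanSpace ℝ (Fin 4)) (𝓡 4) (extChartAt (𝓡 4) p).symm x).IsInvertible := by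
  have := isInvertible_mfderivWithin_extChartAt_symm (I := 𝓡 4) hx
  rwa [ModelWithCorners.range_eq_univ, mfderivWithin_univ] at this

theorem chartSymmDeriv_chartField (hx : x ∈ (extChartAt (𝓡 4) p).target) (X : VecField V) :
    chartSymmDeriv p x (chartField p X x) = X ((extChartAt (𝓡 4) p).symm x) := by
  obtain ⟨e, he⟩ := isInvertible_chart_symm hx
  have h : chartField p X x = e.symm (X ((extChartAt (𝓡 4) p).symm x)) := by
    rw [chartField, VectorField.mpullback_apply, ← he, ContinuousLinearMap.inverse_equiv]
    rfl
  rw [h]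
  unfold chartSymmDeriv
  rw [← he]
  exact e.apply_symm_apply _

theorem chartSymmDeriv_injective (hx : x ∈ (extChartAt (𝓡 4) p).target) :
    Function.Injective (chartSymmDeriv p x) := by
  obtain ⟨e, he⟩ := isInvertible_chart_symm hx
  unfold chartSymmDeriv
  rw [← he]
  exact e.injective

theorem chartMetric_chartField (g : LorentzianMetric V) (hx : x ∈ (extChartAt (𝓡 4) p).target)
    (X Y : VecField V) :
    chartMetric g p x (chartField p X x) (chartField p Y x)
      = g.inner X Y ((extChartAt (𝓡 4) p).symm x) := by
  rw [chartMetric_apply, chartSymmDeriv_chartField hx, chartSymmDeriv_chartField hx]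
  rfl

theorem contDiffAt_chartField (hx : x ∈ (extChartAt (𝓡 4) p).target) {X : VecField V}
    (hX : SmoothFieldAt X ((extChartAt (𝓡 4) p).symm x)) : ContDiffAt ℝ ∞ (chartField p X) x := by
  have := ContMDiffAt.mpullback_vectorField_preimage (m := ∞) (n := ∞) hX
    (contMDiffAt_chart_symm hx) (isInvertible_chart_symm hx) (by simp)
  exact contMDiffAt_vectorSpace_iff_contDiffAt.1 this

theorem smoothFieldAt_coordField {q : V} (hq : q ∈ (extChartAt (𝓡 4) p).source)
    (v : EuclideanSpace ℝ (Fin 4)) : SmoothFieldAt (coordField p v) q := by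
  have hc : ContMDiffAt (𝓡 4) 𝓘(ℝ, EuclideanSpace ℝ (Fin 4)) ∞ (extChartAt (𝓡 4) p) q :=
    contMDiffAt_extChartAt' (by rwa [extChartAt_source] at hq)
  refine ContMDiffAt.mpullback_vectorField_preimage (m := ∞) (n := ∞) ?_ hc
    (isInvertible_mfderiv_extChartAt hq) (by simp)
  exact contMDiffAt_vectorSpace_iff_contDiffAt.2 contDiffAt_const

theorem chartField_coordField (hx : x ∈ (extChartAt (𝓡 4) p).target)
    (v : EuclideanSpace ℝ (Fin 4)) : chartField p (coordField p v) x = v := by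
  apply chartSymmDeriv_injective hx
  rw [chartSymmDeriv_chartField hx]
  have h1 := mfderivWithin_extChartAt_symm_comp_mfderiv_extChartAt (I := 𝓡 4) hx
  have h2 := mfderiv_extChartAt_comp_mfderivWithin_extChartAt_symm (I := 𝓡 4) hx
  rw [ModelWithCorners.range_eq_univ, mfderivWithin_univ] at h1 h2
  exact congrArg (fun L ↦ L v) (ContinuousLinearMap.inverse_eq h2 h1)

theorem eventually_chartField_coordField (hx : x ∈ (extChartAt (𝓡 4) p).target)
    (v : EuclideanSpace ℝ (Fin 4)) : chartField p (coordField p v) =ᶠ[𝓝 x] fun _ ↦ v :=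
  ((isOpen_extChartAt_target p).eventually_mem hx).mono fun _ hy ↦ chartField_coordField hy v

theorem contMDiffAt_inner (g : LorentzianMetric V) {q : V} {X Y : VecField V}
    (hX : SmoothFieldAt X q) (hY : SmoothFieldAt Y q) :
    ContMDiffAt (𝓡 4) 𝓘(ℝ, ℝ) ∞ (g.inner X Y) q := by
  have := ContMDiffAt.clm_bundle_apply₂ (F₁ := EuclideanSpace ℝ (Fin 4))
    (F₂ := EuclideanSpace ℝ (Fin 4)) (F₃ := ℝ) (E₁ := fun q : V ↦ TangentSpace (𝓡 4) q)
    (E₂ := fun q : V ↦ TangentSpace (𝓡 4) q) (E₃ := Bundle.Trivial V ℝ) (b := fun q : V ↦ q)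
    (IB := 𝓡 4) (IM := 𝓡 4) (n := ∞) (ψ := fun q ↦ g.val q) (v := X) (w := Y) (x := q)
    g.contMDiff.contMDiffAt hX hY
  rw [Bundle.contMDiffAt_totalSpace] at this
  exact this.2

theorem contDiffAt_chartMetric (g : LorentzianMetric V) (hx : x ∈ (extChartAt (𝓡 4) p).target) :
    ContDiffAt ℝ ∞ (chartMetric g p) x := by
  have h : ContDiffOn ℝ ∞ (chartMetric g p) (extChartAt (𝓡 4) p).target := by
    rw [contDiffOn_clm_apply]
    intro v
    rw [contDiffOn_clm_apply]
    intro w y hy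
    have hs := (extChartAt (𝓡 4) p).map_target hy
    have h1 := (contMDiffAt_inner g (smoothFieldAt_coordField hs v)
      (smoothFieldAt_coordField hs w)).comp y (contMDiffAt_chart_symm hy)
    refine (h1.contDiffAt.congr_of_eventuallyEq ?_).contDiffWithinAt
    filter_upwards [(isOpen_extChartAt_target p).eventually_mem hy] with z hz
    have := chartMetric_chartField g hz (coordField p v) (coordField p w)
    rwa [chartField_coordField hz, chartField_coordField hz] at this
  exact h.contDiffAt ((isOpen_extChartAt_target p).mem_nhds hx)

theorem dirDeriv_eq_fderiv (hx : x ∈ (extChartAt (𝓡 4) p).target) (X : VecField V) {f : V → ℝ}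
    (hf : MDifferentiableAt (𝓡 4) 𝓘(ℝ, ℝ) f ((extChartAt (𝓡 4) p).symm x)) :
    dirDeriv X f ((extChartAt (𝓡 4) p).symm x)
      = fderiv ℝ (f ∘ (extChartAt (𝓡 4) p).symm) x (chartField p X x) := by
  have h := mvfderiv_comp_apply x hf ((contMDiffAt_chart_symm hx).mdifferentiableAt (by simp))
    (chartField p X x)
  have h2 : (mfderiv 𝓘(ℝ, EuclideanSpace ℝ (Fin 4)) (𝓡 4) (extChartAt (𝓡 4) p).symm x)
    (chartField p X x) = X ((extChartAt (𝓡 4) p).symm x) := chartSymmDeriv_chartField hx X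
  rw [h2] at h
  unfold dirDeriv
  rw [← h]
  unfold mvfderiv
  rw [mfderiv_eq_fderiv]
  rfl

theorem mlieBracket_eq_lieBracket {E : Type*} [NormedAddCommGroup E] [NormedSpace ℝ E]
    (X Y : Π x : E, TangentSpace 𝓘(ℝ, E) x) :
    VectorField.mlieBracket 𝓘(ℝ, E) X Y = VectorField.lieBracket ℝ X Y := by
  rw [← VectorField.mlieBracketWithin_univ, VectorField.mlieBracketWithin_eq_lieBracketWithin]
  exact VectorField.lieBracketWithin_univ (V := X) (W := Y)

theorem chartField_mlieBracket (hx : x ∈ (extChartAt (𝓡 4) p).target) {X Y : VecField V}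
    (hX : SmoothFieldAt X ((extChartAt (𝓡 4) p).symm x))
    (hY : SmoothFieldAt Y ((extChartAt (𝓡 4) p).symm x)) :
    chartField p (VectorField.mlieBracket (𝓡 4) X Y) x
      = fderiv ℝ (chartField p Y) x (chartField p X x)
        - fderiv ℝ (chartField p X) x (chartField p Y x) := by
  have h := VectorField.mpullback_mlieBracket (𝕜 := ℝ) (I := 𝓘(ℝ, EuclideanSpace ℝ (Fin 4)))
    (I' := 𝓡 4) (n := minSmoothness ℝ 2) (x₀ := x) (f := (extChartAt (𝓡 4) p).symm)
    (hX.mdifferentiableAt (by simp)) (hY.mdifferentiableAt (by simp))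
    ((contMDiffAt_chart_symm hx).of_le (by
      rw [minSmoothness_of_isRCLikeNormedField]; exact ENat.LEInfty.out)) le_rfl
  refine h.trans ?_
  exact congrFun (mlieBracket_eq_lieBracket (chartField p X) (chartField p Y)) x

end Transfer

/-! ### Sums over permutations -/

theorem sum_sign_perm_fin_three (f : Fin 3 → Fin 3 → Fin 3 → ℝ) :
    ∑ σ : Equiv.Perm (Fin 3), ((Equiv.Perm.sign σ : ℤ) : ℝ) * f (σ 0) (σ 1) (σ 2) =
      f 0 1 2 - f 0 2 1 - f 1 0 2 + f 1 2 0 + f 2 0 1 - f 2 1 0 := by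
  have : (Finset.univ : Finset (Equiv.Perm (Fin 3))) =
      {1, Equiv.swap 1 2, Equiv.swap 0 1, Equiv.swap 0 1 * Equiv.swap 1 2,
        Equiv.swap 1 2 * Equiv.swap 0 1, Equiv.swap 0 2} := by decide
  rw [this, Finset.sum_insert (by decide), Finset.sum_insert (by decide),
    Finset.sum_insert (by decide), Finset.sum_insert (by decide), Finset.sum_insert (by decide),
    Finset.sum_singleton]
  simp [Equiv.swap_apply_def, Equiv.Perm.sign_swap']
  ring

/-- Only the permutations preserving `{0, 1}` contribute to the alternation of a form which
vanishes when one of its first two arguments is among the last two vectors. -/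
theorem sum_sign_perm_fin_four (f : Fin 4 → Fin 4 → Fin 4 → Fin 4 → ℝ)
    (hf : ∀ i j k l, i ∈ ({2, 3} : Finset (Fin 4)) ∨ j ∈ ({2, 3} : Finset (Fin 4)) →
      f i j k l = 0) :
    ∑ σ : Equiv.Perm (Fin 4), ((Equiv.Perm.sign σ : ℤ) : ℝ) * f (σ 0) (σ 1) (σ 2) (σ 3) =
      f 0 1 2 3 - f 1 0 2 3 - f 0 1 3 2 + f 1 0 3 2 := by
  rw [← Finset.sum_subset (Finset.subset_univ ({1, Equiv.swap 0 1, Equiv.swap 2 3,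
    Equiv.swap 0 1 * Equiv.swap 2 3} : Finset (Equiv.Perm (Fin 4))))]
  · rw [Finset.sum_insert (by decide), Finset.sum_insert (by decide),
      Finset.sum_insert (by decide), Finset.sum_singleton]
    simp [Equiv.swap_apply_def, Equiv.Perm.sign_swap']
    ring
  · intro σ _ hσ
    have key : ∀ σ : Equiv.Perm (Fin 4), σ ∉ ({1, Equiv.swap 0 1, Equiv.swap 2 3,
        Equiv.swap 0 1 * Equiv.swap 2 3} : Finset (Equiv.Perm (Fin 4))) →
        σ 0 ∈ ({2, 3} : Finset (Fin 4)) ∨ σ 1 ∈ ({2, 3} : Finset (Fin 4)) := by decide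
    rw [hf _ _ _ _ (key σ hσ), mul_zero]

/-! ### Integrability of a field orthogonal to the orbits -/

section Integrable

variable {E : Type*} [NormedAddCommGroup E] [NormedSpace ℝ E] {G : E → E →L[ℝ] E →L[ℝ] ℝ}
  {Ω : Set E} {X : Fin 3 → E → E}

namespace OrthTransitiveTriple

theorem wedge_dFlat_eq_zero_of_gramDet_ne_zero (T : OrthTransitiveTriple Ω G X)
    (hdim : Module.finrank ℝ E = 4) (h0 : ∀ y ∈ Ω, gram G X 2 0 y = 0)
    (h1 : ∀ y ∈ Ω, gram G X 2 1 y = 0) {x : E} (hx : x ∈ Ω) (hD : gramDet G X x ≠ 0)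
    (Y : Fin 3 → E) :
    G x (X 2 x) (Y 0) * dFlat G (X 2) x (Y 1) (Y 2) + G x (X 2 x) (Y 1) * dFlat G (X 2) x (Y 2) (Y 0)
      + G x (X 2 x) (Y 2) * dFlat G (X 2) x (Y 0) (Y 1) = 0 := by
  have : FiniteDimensional ℝ E := Module.finite_of_finrank_pos (by omega)
  have hω : ∀ j, (∀ y ∈ Ω, gram G X 2 j y = 0) → ∀ w, dFlat G (X 2) x w (X j x) = 0 := by
    intro j hj w
    rw [← T.fderiv_gram 2 j hx]
    have : gram G X 2 j =ᶠ[𝓝 x] fun _ ↦ 0 := (T.isOpen.eventually_mem hx).mono hj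
    rw [this.fderiv_eq]
    simp
  -- `X 0`, `X 1` and the three given vectors are linearly dependent
  obtain ⟨c, hc, i, hi⟩ := Fintype.not_linearIndependent_iff.1
    (fun h : LinearIndependent ℝ ![X 0 x, X 1 x, Y 0, Y 1, Y 2] ↦ by
      have := h.fintype_card_le_finrank
      simp [hdim] at this)
  have hsum : c 0 • X 0 x + c 1 • X 1 x + c 2 • Y 0 + c 3 • Y 1 + c 4 • Y 2 = 0 := by
    simpa [Fin.sum_univ_succ, add_assoc] using hc
  have eθ : c 2 * G x (X 2 x) (Y 0) + c 3 * G x (X 2 x) (Y 1) + c 4 * G x (X 2 x) (Y 2) = 0 := by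
    have := congrArg (fun v ↦ G x (X 2 x) v) hsum
    have e0 := h0 x hx
    have e1 := h1 x hx
    simp only [gram] at e0 e1
    simpa [e0, e1] using this
  have eω : ∀ w, c 2 * dFlat G (X 2) x w (Y 0) + c 3 * dFlat G (X 2) x w (Y 1)
      + c 4 * dFlat G (X 2) x w (Y 2) = 0 := by
    intro w
    have := congrArg (fun v ↦ dFlat G (X 2) x w v) hsum
    simp only [dFlat_add_right, dFlat_smul_right, hω 0 h0, hω 1 h1] at this
    have z : dFlat G (X 2) x w 0 = 0 := by simp [dFlat]
    rw [z] at this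
    linarith
  have hne : c 2 ≠ 0 ∨ c 3 ≠ 0 ∨ c 4 ≠ 0 := by
    by_contra! hcon
    obtain ⟨c2, c3, c4⟩ := hcon
    rw [c2, c3, c4] at hsum
    simp only [zero_smul, add_zero] at hsum
    have hs : G x (X 1 x) (X 0 x) = G x (X 0 x) (X 1 x) := T.symm x hx _ _
    have f0 := congrArg (fun v ↦ G x (X 0 x) v) hsum
    have f1 := congrArg (fun v ↦ G x (X 1 x) v) hsum
    simp only [map_add, map_smul, smul_eq_mul, map_zero, hs] at f0 f1
    have c0 : c 0 = 0 := by
      have : gramDet G X x * c 0 = 0 := by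
        simp only [gramDet, gram]
        linear_combination (G x (X 1 x) (X 1 x)) * f0 - (G x (X 0 x) (X 1 x)) * f1
      exact (mul_eq_zero.1 this).resolve_left hD
    have c1 : c 1 = 0 := by
      have : gramDet G X x * c 1 = 0 := by
        simp only [gramDet, gram]
        linear_combination (G x (X 0 x) (X 0 x)) * f1 - (G x (X 0 x) (X 1 x)) * f0
      exact (mul_eq_zero.1 this).resolve_left hD
    fin_cases i <;> contradiction
  have w0 := eω (Y 0)
  have w1 := eω (Y 1)
  have w2 := eω (Y 2)
  have s0 : ∀ v, dFlat G (X 2) x v v = 0 := fun v ↦ by simp [dFlat]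
  rw [dFlat_swap (Y 1) (Y 0)] at w1
  rw [dFlat_swap (Y 2) (Y 1)] at w2
  rw [dFlat_swap (Y 0) (Y 2)] at w0
  rw [s0] at w0 w1 w2
  rcases hne with h | h | h
  · refine (mul_eq_zero.1 ?_ : c 2 = 0 ∨ _).resolve_left h
    linear_combination (dFlat G (X 2) x (Y 1) (Y 2)) * eθ - (G x (X 2 x) (Y 2)) * w1
      + (G x (X 2 x) (Y 1)) * w2
  · refine (mul_eq_zero.1 ?_ : c 3 = 0 ∨ _).resolve_left h
    linear_combination (dFlat G (X 2) x (Y 2) (Y 0)) * eθ - (G x (X 2 x) (Y 0)) * w2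
      + (G x (X 2 x) (Y 2)) * w0
  · refine (mul_eq_zero.1 ?_ : c 4 = 0 ∨ _).resolve_left h
    linear_combination (dFlat G (X 2) x (Y 0) (Y 1)) * eθ - (G x (X 2 x) (Y 1)) * w0
      + (G x (X 2 x) (Y 0)) * w1

theorem continuousAt_dFlat (T : OrthTransitiveTriple Ω G X) (i : Fin 3) {x : E} (hx : x ∈ Ω)
    (v w : E) : ContinuousAt (fun y ↦ dFlat G (X i) y v w) x := by
  have hG := T.smooth_metric x hx
  have hX := T.smooth i x hx
  have hG' : ContDiffAt ℝ ∞ (fderiv ℝ G) x := hG.fderiv_right (by simp)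
  have hX' : ContDiffAt ℝ ∞ (fderiv ℝ (X i)) x := hX.fderiv_right (by simp)
  have h : ∀ a b : E, ContinuousAt
      (fun y ↦ fderiv ℝ G y a (X i y) b + G y (fderiv ℝ (X i) y a) b) x := fun a b ↦
    (((((hG'.clm_apply contDiffAt_const).clm_apply hX).clm_apply contDiffAt_const)).add
      ((hG.clm_apply (hX'.clm_apply contDiffAt_const)).clm_apply contDiffAt_const)).continuousAt
  exact (h v w).sub (h w v)

/-- If `X 2` is orthogonal to the orbits of `X 0` and `X 1`, then `ω ∧ dω = 0` for
`ω = G(X 2, ·)`: where the orbits are two-dimensional, this 3-form is annihilated by `X 0` and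
`X 1`, and the quotient of the tangent space by these is only two-dimensional. -/
theorem wedge_dFlat_eq_zero (T : OrthTransitiveTriple Ω G X)
    (hdim : Module.finrank ℝ E = 4) (h0 : ∀ y ∈ Ω, gram G X 2 0 y = 0)
    (h1 : ∀ y ∈ Ω, gram G X 2 1 y = 0) {x : E} (hx : x ∈ Ω) (Y : Fin 3 → E) :
    G x (X 2 x) (Y 0) * dFlat G (X 2) x (Y 1) (Y 2) + G x (X 2 x) (Y 1) * dFlat G (X 2) x (Y 2) (Y 0)
      + G x (X 2 x) (Y 2) * dFlat G (X 2) x (Y 0) (Y 1) = 0 := by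
  by_contra hne
  have hθ : ∀ v, ContinuousAt (fun y ↦ G y (X 2 y) v) x := fun v ↦
    (((T.smooth_metric x hx).clm_apply (T.smooth 2 x hx)).clm_apply
      contDiffAt_const).continuousAt
  have hc := (((hθ (Y 0)).mul (T.continuousAt_dFlat 2 hx (Y 1) (Y 2))).add
    ((hθ (Y 1)).mul (T.continuousAt_dFlat 2 hx (Y 2) (Y 0)))).add
    ((hθ (Y 2)).mul (T.continuousAt_dFlat 2 hx (Y 0) (Y 1)))
  obtain ⟨y, hy, hy', hyΩ⟩ := ((T.dense x hx).and_eventually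
    ((hc.eventually_ne hne).and (T.isOpen.eventually_mem hx))).exists
  exact hy' (T.wedge_dFlat_eq_zero_of_gramDet_ne_zero hdim h0 h1 hyΩ hy Y)

end OrthTransitiveTriple

end Integrable

/-! ### Killing fields in a chart -/

section TransferKilling

variable {V : Type*} [TopologicalSpace V] [ChartedSpace (EuclideanSpace ℝ (Fin 4)) V]
  [IsManifold (𝓡 4) ∞ V] {g : LorentzianMetric V} {p : V} {x : EuclideanSpace ℝ (Fin 4)}

theorem chartField_smul_add_smul (hx : x ∈ (extChartAt (𝓡 4) p).target) (a b : ℝ)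
    (X Y : VecField V) :
    chartField p (a • X + b • Y) x = a • chartField p X x + b • chartField p Y x := by
  apply chartSymmDeriv_injective hx
  rw [map_add, map_smul, map_smul, chartSymmDeriv_chartField hx, chartSymmDeriv_chartField hx,
    chartSymmDeriv_chartField hx]
  rfl

theorem chartField_sub (hx : x ∈ (extChartAt (𝓡 4) p).target) (X Y : VecField V) :
    chartField p (X - Y) x = chartField p X x - chartField p Y x := by
  apply chartSymmDeriv_injective hx
  rw [map_sub, chartSymmDeriv_chartField hx, chartSymmDeriv_chartField hx,
    chartSymmDeriv_chartField hx]
  rfl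

theorem chartMetric_symm (v w : EuclideanSpace ℝ (Fin 4)) :
    chartMetric g p x v w = chartMetric g p x w v :=
  g.symm _ _ _

theorem dirDeriv_inner (hx : x ∈ (extChartAt (𝓡 4) p).target) (X : VecField V) {Y Z : VecField V}
    (hY : SmoothFieldAt Y ((extChartAt (𝓡 4) p).symm x))
    (hZ : SmoothFieldAt Z ((extChartAt (𝓡 4) p).symm x)) :
    dirDeriv X (g.inner Y Z) ((extChartAt (𝓡 4) p).symm x) =
      fderiv ℝ (chartMetric g p) x (chartField p X x) (chartField p Y x) (chartField p Z x)
      + chartMetric g p x (fderiv ℝ (chartField p Y) x (chartField p X x)) (chartField p Z x)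
      + chartMetric g p x (chartField p Y x) (fderiv ℝ (chartField p Z) x (chartField p X x)) := by
  rw [dirDeriv_eq_fderiv hx X ((contMDiffAt_inner g hY hZ).mdifferentiableAt (by simp)),
    ← fderiv_metric ((contDiffAt_chartMetric g hx).differentiableAt (by simp))
      ((contDiffAt_chartField hx hY).differentiableAt (by simp))
      ((contDiffAt_chartField hx hZ).differentiableAt (by simp))]
  congr 1
  refine Filter.EventuallyEq.fderiv_eq ?_
  filter_upwards [(isOpen_extChartAt_target p).eventually_mem hx] with y hy
  exact (chartMetric_chartField g hy Y Z).symm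

theorem d_eq_dFlat (hx : x ∈ (extChartAt (𝓡 4) p).target) {ξ X Y : VecField V}
    (hξ : SmoothFieldAt ξ ((extChartAt (𝓡 4) p).symm x))
    (hX : SmoothFieldAt X ((extChartAt (𝓡 4) p).symm x))
    (hY : SmoothFieldAt Y ((extChartAt (𝓡 4) p).symm x)) :
    g.d ξ X Y ((extChartAt (𝓡 4) p).symm x)
      = dFlat (chartMetric g p) (chartField p ξ) x (chartField p X x) (chartField p Y x) := by
  rw [LorentzianMetric.d, dirDeriv_inner hx X hξ hY, dirDeriv_inner hx Y hξ hX,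
    ← chartMetric_chartField g hx, chartField_mlieBracket hx hX hY, map_sub, dFlat]
  ring

theorem IsKilling.isKillingAt {X : VecField V} (hX : IsKilling g X)
    (hx : x ∈ (extChartAt (𝓡 4) p).target) :
    IsKillingAt (chartMetric g p) (chartField p X) x := by
  intro v w
  have hs := (extChartAt (𝓡 4) p).map_target hx
  have hv := smoothFieldAt_coordField hs v
  have hw := smoothFieldAt_coordField hs w
  have h := hX.lie_metric _ (coordField p v) (coordField p w) hv hw
  have z : ∀ u, fderiv ℝ (chartField p (coordField p u)) x = 0 := fun u ↦ by
    rw [(eventually_chartField_coordField hx u).fderiv_eq]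
    simp
  rw [dirDeriv_inner hx X hv hw, ← chartMetric_chartField g hx, ← chartMetric_chartField g hx,
    chartField_mlieBracket hx (hX.smooth _) hv, chartField_mlieBracket hx (hX.smooth _) hw,
    z, z, chartField_coordField hx, chartField_coordField hx] at h
  simpa using h

theorem fderiv_chartField_comm {X Y : VecField V} (hX : IsKilling g X) (hY : IsKilling g Y)
    (hXY : VectorField.mlieBracket (𝓡 4) X Y = 0) (hx : x ∈ (extChartAt (𝓡 4) p).target) :
    fderiv ℝ (chartField p X) x (chartField p Y x)
      = fderiv ℝ (chartField p Y) x (chartField p X x) := by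
  have h := chartField_mlieBracket hx (hX.smooth _) (hY.smooth _)
  have h0 : chartField p (VectorField.mlieBracket (𝓡 4) X Y) x = 0 := by
    apply chartSymmDeriv_injective hx
    rw [chartSymmDeriv_chartField hx, hXY, map_zero]
    rfl
  rw [h0] at h
  exact (sub_eq_zero.1 h.symm).symm

/-- The reversed Cauchy-Schwarz inequality: the orthogonal complement of a timelike vector is
spacelike. -/
theorem LorentzianMetric.pos_of_orthogonal_timelike (g : LorentzianMetric V) (p : V)
    {z w : TangentSpace (𝓡 4) p} (hz : g.val p z z < 0) (hzw : g.val p z w = 0) (hw : w ≠ 0) :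
    0 < g.val p w w := by
  obtain ⟨e, he⟩ := g.signature p
  have hexp : ∀ u v, g.val p u v = -(e.repr u 0 * e.repr v 0) + e.repr u 1 * e.repr v 1
      + e.repr u 2 * e.repr v 2 + e.repr u 3 * e.repr v 3 := by
    intro u v
    have H : ∀ a b : Fin 4 → ℝ, g.val p (∑ i, a i • e i) (∑ i, b i • e i)
        = -(a 0 * b 0) + a 1 * b 1 + a 2 * b 2 + a 3 * b 3 := by
      intro a b
      simp [Fin.sum_univ_four, he]
    have := H (e.repr u) (e.repr v)
    rwa [e.sum_repr, e.sum_repr] at this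
  rw [hexp] at hz hzw ⊢
  by_contra! hcon
  generalize e.repr z 0 = a0 at *
  generalize e.repr z 1 = a1 at *
  generalize e.repr z 2 = a2 at *
  generalize e.repr z 3 = a3 at *
  have hw' : ¬ (e.repr w 0 = 0 ∧ e.repr w 1 = 0 ∧ e.repr w 2 = 0 ∧ e.repr w 3 = 0) := by
    rintro ⟨h0, h1, h2, h3⟩
    apply hw
    apply e.repr.injective
    ext i
    fin_cases i <;> simp [h0, h1, h2, h3]
  generalize e.repr w 0 = b0 at *
  generalize e.repr w 1 = b1 at *
  generalize e.repr w 2 = b2 at *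
  generalize e.repr w 3 = b3 at *
  have hA : a1 ^ 2 + a2 ^ 2 + a3 ^ 2 < a0 ^ 2 := by nlinarith
  have hB : b1 ^ 2 + b2 ^ 2 + b3 ^ 2 ≤ b0 ^ 2 := by nlinarith
  have hCS : (a0 * b0) ^ 2 ≤ (a1 ^ 2 + a2 ^ 2 + a3 ^ 2) * (b1 ^ 2 + b2 ^ 2 + b3 ^ 2) := by
    have : a0 * b0 = a1 * b1 + a2 * b2 + a3 * b3 := by linarith
    rw [this]
    nlinarith [sq_nonneg (a1 * b2 - a2 * b1), sq_nonneg (a1 * b3 - a3 * b1),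
      sq_nonneg (a2 * b3 - a3 * b2)]
  have h1 : (a1 ^ 2 + a2 ^ 2 + a3 ^ 2) * (b1 ^ 2 + b2 ^ 2 + b3 ^ 2)
      ≤ (a1 ^ 2 + a2 ^ 2 + a3 ^ 2) * b0 ^ 2 := by gcongr
  have h2 : b0 ^ 2 = 0 := by
    by_contra hb
    have hb' : 0 < b0 ^ 2 := lt_of_le_of_ne (sq_nonneg _) (Ne.symm hb)
    have := mul_lt_mul_of_pos_right hA hb'
    nlinarith
  have hb0 : b0 = 0 := by simpa using h2
  rw [h2] at hB
  have p1 : b1 ^ 2 = 0 := le_antisymm (by nlinarith [sq_nonneg b2, sq_nonneg b3]) (sq_nonneg _)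
  have p2 : b2 ^ 2 = 0 := le_antisymm (by nlinarith [sq_nonneg b1, sq_nonneg b3]) (sq_nonneg _)
  have p3 : b3 ^ 2 = 0 := le_antisymm (by nlinarith [sq_nonneg b2, sq_nonneg b1]) (sq_nonneg _)
  exact hw' ⟨hb0, by simpa using p1, by simpa using p2, by simpa using p3⟩

/-- `𝛏 ∧ 𝛈 ∧ d𝛏 = 0` says that `d𝛏` vanishes on the orthogonal complement of the orbits. -/
theorem WedgeWedgeDZero.dFlat_eq_zero {ξ η : VecField V} (h : WedgeWedgeDZero g ξ η)
    (hξ : IsKilling g ξ) (hη : IsKilling g η) (hx : x ∈ (extChartAt (𝓡 4) p).target)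
    (hD : chartMetric g p x (chartField p ξ x) (chartField p ξ x)
      * chartMetric g p x (chartField p η x) (chartField p η x)
      - chartMetric g p x (chartField p ξ x) (chartField p η x) ^ 2 ≠ 0)
    {v w : EuclideanSpace ℝ (Fin 4)} (hξv : chartMetric g p x (chartField p ξ x) v = 0)
    (hηv : chartMetric g p x (chartField p η x) v = 0)
    (hξw : chartMetric g p x (chartField p ξ x) w = 0)
    (hηw : chartMetric g p x (chartField p η x) w = 0) :
    dFlat (chartMetric g p) (chartField p ξ) x v w = 0 := by
  have hs := (extChartAt (𝓡 4) p).map_target hx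
  have hv := smoothFieldAt_coordField hs v
  have hw := smoothFieldAt_coordField hs w
  let Y : Fin 4 → VecField V := ![ξ, η, coordField p v, coordField p w]
  have hY : ∀ i, SmoothFieldAt (Y i) ((extChartAt (𝓡 4) p).symm x) := by
    intro i
    fin_cases i
    · exact hξ.smooth _
    · exact hη.smooth _
    · exact hv
    · exact hw
  have key := h _ Y hY
  rw [sum_sign_perm_fin_four (fun i j k l ↦ g.inner ξ (Y i) ((extChartAt (𝓡 4) p).symm x)
    * g.inner η (Y j) ((extChartAt (𝓡 4) p).symm x)
    * g.d ξ (Y k) (Y l) ((extChartAt (𝓡 4) p).symm x))] at key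
  · simp only [← chartMetric_chartField g hx, d_eq_dFlat hx (hξ.smooth _) (hY _) (hY _)] at key
    simp only [Y, Matrix.cons_val, chartField_coordField hx] at key
    rw [dFlat_swap w v, chartMetric_symm (chartField p η x) (chartField p ξ x)] at key
    refine (mul_eq_zero.1 ?_).resolve_left hD
    linear_combination key / 2
  · rintro i j k l (hi | hj)
    · have : g.inner ξ (Y i) ((extChartAt (𝓡 4) p).symm x) = 0 := by
        rw [← chartMetric_chartField g hx]
        simp only [Finset.mem_insert, Finset.mem_singleton] at hi
        rcases hi with rfl | rfl
        · simpa [Y, chartField_coordField hx] using hξv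
        · simpa [Y, chartField_coordField hx] using hξw
      simp only [this, zero_mul]
    · have : g.inner η (Y j) ((extChartAt (𝓡 4) p).symm x) = 0 := by
        rw [← chartMetric_chartField g hx]
        simp only [Finset.mem_insert, Finset.mem_singleton] at hj
        rcases hj with rfl | rfl
        · simpa [Y, chartField_coordField hx] using hηv
        · simpa [Y, chartField_coordField hx] using hηw
      simp only [this, mul_zero, zero_mul]

end TransferKilling

/-! ### The orthogonal projection of the timelike field -/

section Projection

variable {V : Type*} [TopologicalSpace V] [ChartedSpace (EuclideanSpace ℝ (Fin 4)) V]

/-- `ξ` and `η` span `𝔥`. -/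
def IsSpannedBy (𝔥 : Submodule ℝ (VecField V)) (ξ η : VecField V) : Prop :=
  ξ ∈ 𝔥 ∧ η ∈ 𝔥 ∧ ∀ σ ∈ 𝔥, ∃ a b : ℝ, σ = a • ξ + b • η

theorem IsSpannedBy.smul_add_smul_mem {𝔥 : Submodule ℝ (VecField V)} {ξ η : VecField V}
    (h : IsSpannedBy 𝔥 ξ η) (a b : ℝ) : a • ξ + b • η ∈ 𝔥 :=
  𝔥.add_mem (𝔥.smul_mem a h.1) (𝔥.smul_mem b h.2.1)

theorem exists_isSpannedBy {𝔥 : Submodule ℝ (VecField V)} (h : Module.rank ℝ 𝔥 = 2) :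
    ∃ ξ η, IsSpannedBy 𝔥 ξ η := by
  have hfin : Module.finrank ℝ 𝔥 = 2 := Module.finrank_eq_of_rank_eq h
  have : Module.Finite ℝ 𝔥 := Module.finite_of_finrank_pos (by omega)
  let b := Module.finBasisOfFinrankEq ℝ 𝔥 hfin
  refine ⟨b 0, b 1, (b 0).2, (b 1).2, fun σ hσ ↦ ⟨b.repr ⟨σ, hσ⟩ 0, b.repr ⟨σ, hσ⟩ 1, ?_⟩⟩
  have h1 := congrArg Subtype.val (b.sum_repr ⟨σ, hσ⟩)
  rw [Fin.sum_univ_two] at h1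
  exact h1.symm

variable [IsManifold (𝓡 4) ∞ V] {g : LorentzianMetric V}

/-- The Gram determinant of two vector fields. -/
noncomputable def fieldGramDet (g : LorentzianMetric V) (ξ η : VecField V) (q : V) : ℝ :=
  g.inner ξ ξ q * g.inner η η q - g.inner ξ η q ^ 2

theorem inner_smul_add_smul_left (a b : ℝ) (X Y Z : VecField V) (q : V) :
    g.inner (a • X + b • Y) Z q = a * g.inner X Z q + b * g.inner Y Z q := by
  have : (a • X + b • Y) q = a • X q + b • Y q := rfl
  simp [LorentzianMetric.inner, this]

theorem inner_sub_left (X Y Z : VecField V) (q : V) :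
    g.inner (X - Y) Z q = g.inner X Z q - g.inner Y Z q := by
  have : (X - Y) q = X q - Y q := rfl
  simp [LorentzianMetric.inner, this]

theorem inner_comm (X Y : VecField V) (q : V) : g.inner X Y q = g.inner Y X q :=
  g.symm q _ _

theorem gramDet_chartField {ξ η : VecField V} (ζ : VecField V) {p : V}
    {x : EuclideanSpace ℝ (Fin 4)} (hx : x ∈ (extChartAt (𝓡 4) p).target) :
    gramDet (chartMetric g p) ![chartField p ξ, chartField p η, chartField p ζ] x
      = fieldGramDet g ξ η ((extChartAt (𝓡 4) p).symm x) := by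
  simp only [fieldGramDet, ← chartMetric_chartField g hx]
  rfl

theorem orthTransitiveTriple_chart (p : V) {ξ η ζ : VecField V} (hξ : IsKilling g ξ)
    (hη : IsKilling g η) (hζ : IsKilling g ζ) (hξη : VectorField.mlieBracket (𝓡 4) ξ η = 0)
    (hξζ : VectorField.mlieBracket (𝓡 4) ξ ζ = 0) (hηζ : VectorField.mlieBracket (𝓡 4) η ζ = 0)
    (htime : IsTimelike g ζ)
    (hspace : ∀ q, ∀ a b : ℝ, a • ξ q + b • η q ≠ 0 →
      0 < g.val q (a • ξ q + b • η q) (a • ξ q + b • η q))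
    (hdense : Dense {q | fieldGramDet g ξ η q ≠ 0}) (h₁ : WedgeWedgeDZero g ξ η)
    (h₂ : WedgeWedgeDZero g η ξ) :
    OrthTransitiveTriple (extChartAt (𝓡 4) p).target (chartMetric g p)
      ![chartField p ξ, chartField p η, chartField p ζ] where
  isOpen := isOpen_extChartAt_target p
  smooth_metric x hx := contDiffAt_chartMetric g hx
  symm x _ v w := chartMetric_symm v w
  lorentz x hx z w hz hzw hw := g.pos_of_orthogonal_timelike _ hz hzw
    fun h ↦ hw (chartSymmDeriv_injective hx (h.trans (map_zero _).symm))
  smooth i x hx := by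
    fin_cases i
    · exact contDiffAt_chartField hx (hξ.smooth _)
    · exact contDiffAt_chartField hx (hη.smooth _)
    · exact contDiffAt_chartField hx (hζ.smooth _)
  killing i x hx := by
    fin_cases i
    · exact hξ.isKillingAt hx
    · exact hη.isKillingAt hx
    · exact hζ.isKillingAt hx
  comm i j x hx := by
    fin_cases i <;> fin_cases j
    · rfl
    · exact fderiv_chartField_comm hξ hη hξη hx
    · exact fderiv_chartField_comm hξ hζ hξζ hx
    · exact (fderiv_chartField_comm hξ hη hξη hx).symm
    · rfl
    · exact fderiv_chartField_comm hη hζ hηζ hx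
    · exact (fderiv_chartField_comm hξ hζ hξζ hx).symm
    · exact (fderiv_chartField_comm hη hζ hηζ hx).symm
    · rfl
  timelike x hx := (chartMetric_chartField g hx ζ ζ).trans_lt (htime _)
  spacelike x hx a b hab := by
    change 0 < chartMetric g p x (a • chartField p ξ x + b • chartField p η x)
      (a • chartField p ξ x + b • chartField p η x)
    change a • chartField p ξ x + b • chartField p η x ≠ 0 at hab
    rw [← chartField_smul_add_smul hx] at hab ⊢
    rw [chartMetric_chartField g hx]
    refine hspace _ a b fun h ↦ hab (chartSymmDeriv_injective hx ?_)
    rw [chartSymmDeriv_chartField hx, map_zero]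
    exact h
  dense x hx := by
    intro hcon
    set q := (extChartAt (𝓡 4) p).symm x with hq
    have hqs : q ∈ (extChartAt (𝓡 4) p).source := (extChartAt (𝓡 4) p).map_target hx
    have hxq : extChartAt (𝓡 4) p q = x := (extChartAt (𝓡 4) p).right_inv hx
    have hcont : ContinuousAt (extChartAt (𝓡 4) p) q := continuousAt_extChartAt' hqs
    rw [ContinuousAt, hxq] at hcont
    have hev := hcont.eventually hcon
    obtain ⟨q', hq', h1, h2⟩ := ((mem_closure_iff_frequently.1 (hdense q)).and_eventually
      (hev.and ((isOpen_extChartAt_source p).eventually_mem hqs))).exists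
    apply h1
    have := gramDet_chartField (g := g) (ξ := ξ) (η := η) ζ ((extChartAt (𝓡 4) p).map_source h2)
    rw [(extChartAt (𝓡 4) p).left_inv h2] at this
    exact fun h ↦ hq' (this.symm.trans h)
  orth x hx hD v w h0v h1v h0w h1w := by
    refine ⟨h₁.dFlat_eq_zero hξ hη hx hD h0v h1v h0w h1w,
      h₂.dFlat_eq_zero hη hξ hx ?_ h1v h0v h1w h0w⟩
    change chartMetric g p x (chartField p ξ x) (chartField p ξ x)
      * chartMetric g p x (chartField p η x) (chartField p η x)
      - chartMetric g p x (chartField p ξ x) (chartField p η x) ^ 2 ≠ 0 at hD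
    rw [chartMetric_symm (chartField p η x) (chartField p ξ x)]
    rwa [mul_comm]

/-- An Abelian algebra of Killing fields with a timelike element, together with a subalgebra
acting orthogonally transitively on spacelike surfaces. -/
structure OrthTransitiveAlgebra (g : LorentzianMetric V) (𝔤 𝔥 : Submodule ℝ (VecField V)) :
    Prop where
  isAbelian : IsAbelian 𝔤
  killing : ∀ X ∈ 𝔤, IsKilling g X
  le : 𝔥 ≤ 𝔤
  rank_eq : Module.rank ℝ 𝔥 = 2
  surfaces : ActsOnSpacelikeSurfaces g 𝔥
  orthTransitive : IsOrthogonallyTransitive g 𝔥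

namespace OrthTransitiveAlgebra

variable {𝔤 𝔥 : Submodule ℝ (VecField V)} (H : OrthTransitiveAlgebra g 𝔤 𝔥)
include H

theorem inner_self_pos {σ : VecField V} (hσ : σ ∈ 𝔥) {q : V} (h : σ q ≠ 0) :
    0 < g.inner σ σ q :=
  H.surfaces.spacelike q (σ q) ⟨σ, hσ, rfl⟩ h

theorem inner_self_nonneg {σ : VecField V} (hσ : σ ∈ 𝔥) (q : V) : 0 ≤ g.inner σ σ q := by
  by_cases h : σ q = 0
  · simp [LorentzianMetric.inner, h]
  · exact (H.inner_self_pos hσ h).le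

/-- Where the Gram determinant vanishes, `ξ` is equal to its projection to `η`. -/
theorem sub_smul_eq_zero {ξ η : VecField V} (hs : IsSpannedBy 𝔥 ξ η) {q : V} (hη : η q ≠ 0)
    (h0 : fieldGramDet g ξ η q = 0) :
    ((1 : ℝ) • ξ + (-(g.inner ξ η q / g.inner η η q)) • η) q = 0 := by
  have hr := H.inner_self_pos hs.2.1 hη
  obtain ⟨c, hc⟩ : ∃ c, c = g.inner ξ η q / g.inner η η q := ⟨_, rfl⟩
  rw [← hc]
  by_contra hz
  have := H.inner_self_pos (hs.smul_add_smul_mem 1 (-c)) hz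
  rw [inner_smul_add_smul_left, inner_comm ξ, inner_comm η, inner_smul_add_smul_left,
    inner_smul_add_smul_left, inner_comm η ξ] at this
  apply this.ne'
  simp only [fieldGramDet] at h0
  have e : g.inner ξ ξ q = g.inner ξ η q ^ 2 / g.inner η η q := by
    rw [eq_div_iff hr.ne']; linarith
  rw [e, hc]
  field_simp
  ring

/-- The Gram determinant vanishes only where the orbits degenerate. -/
theorem fieldGramDet_ne_zero {ξ η : VecField V} (hs : IsSpannedBy 𝔥 ξ η) {q : V}
    (hq : Module.finrank ℝ (orbitTangent 𝔥 q) = 2) : fieldGramDet g ξ η q ≠ 0 := by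
  intro h0
  have hspan : orbitTangent 𝔥 q ≤ Submodule.span ℝ {ξ q, η q} := by
    rintro _ ⟨σ, hσ, rfl⟩
    obtain ⟨a, b, rfl⟩ := hs.2.2 σ hσ
    exact Submodule.mem_span_pair.2 ⟨a, b, rfl⟩
  -- a tangent space spanned by one vector is not two-dimensional
  have hone : ∀ v : TangentSpace (𝓡 4) q, ξ q ∈ Submodule.span ℝ {v} →
      η q ∈ Submodule.span ℝ {v} → False := by
    intro v h1 h2
    have hle : orbitTangent 𝔥 q ≤ Submodule.span ℝ {v} :=
      hspan.trans (Submodule.span_le.2 (by rintro _ (rfl | rfl) <;> assumption))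
    have := (Submodule.finrank_mono hle).trans (finrank_span_le_card ({v} : Set _))
    rw [hq] at this
    simp at this
  have hr : η q ≠ 0 := fun h ↦ hone (ξ q) (Submodule.mem_span_singleton_self _) (by simp [h])
  refine hone (η q) (Submodule.mem_span_singleton.2 ⟨g.inner ξ η q / g.inner η η q, ?_⟩)
    (Submodule.mem_span_singleton_self _)
  have h1 : (1 : ℝ) • ξ q + (-(g.inner ξ η q / g.inner η η q)) • η q = 0 :=
    H.sub_smul_eq_zero hs hr h0
  rw [one_smul, neg_smul, ← sub_eq_add_neg, sub_eq_zero] at h1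
  exact h1.symm

theorem dense_fieldGramDet {ξ η : VecField V} (hs : IsSpannedBy 𝔥 ξ η) :
    Dense {q | fieldGramDet g ξ η q ≠ 0} :=
  H.surfaces.dense_two_dim.mono fun _ hq ↦ H.fieldGramDet_ne_zero hs hq

theorem triple {ξ η ζ : VecField V} (hs : IsSpannedBy 𝔥 ξ η) (hζ : ζ ∈ 𝔤)
    (htime : IsTimelike g ζ) (p : V) :
    OrthTransitiveTriple (extChartAt (𝓡 4) p).target (chartMetric g p)
      ![chartField p ξ, chartField p η, chartField p ζ] :=
  orthTransitiveTriple_chart p (H.killing _ (H.le hs.1)) (H.killing _ (H.le hs.2.1))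
    (H.killing _ hζ) (H.isAbelian _ (H.le hs.1) _ (H.le hs.2.1)) (H.isAbelian _ (H.le hs.1) _ hζ)
    (H.isAbelian _ (H.le hs.2.1) _ hζ) htime
    (fun _ a b h ↦ H.inner_self_pos (hs.smul_add_smul_mem a b) h) (H.dense_fieldGramDet hs)
    (H.orthTransitive _ hs.1 _ hs.2.1) (H.orthTransitive _ hs.2.1 _ hs.1)

/-- Generators of `𝔥` can be chosen such that, if the orbit degenerates at the given point, then
the first one vanishes there. -/
theorem exists_isSpannedBy_adapted (p : V) :
    ∃ ξ η, IsSpannedBy 𝔥 ξ η ∧ (fieldGramDet g ξ η p ≠ 0 ∨ ξ p = 0) := by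
  obtain ⟨ξ, η, hs⟩ := exists_isSpannedBy H.rank_eq
  by_cases h0 : fieldGramDet g ξ η p = 0
  swap
  · exact ⟨ξ, η, hs, Or.inl h0⟩
  by_cases hη : η p = 0
  · refine ⟨η, ξ, ⟨hs.2.1, hs.1, fun σ hσ ↦ ?_⟩, Or.inr hη⟩
    obtain ⟨a, b, h⟩ := hs.2.2 σ hσ
    exact ⟨b, a, by rw [h, add_comm]⟩
  set c := g.inner ξ η p / g.inner η η p
  refine ⟨(1 : ℝ) • ξ + (-c) • η, η, ⟨hs.smul_add_smul_mem 1 (-c), hs.2.1, fun σ hσ ↦ ?_⟩,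
    Or.inr (H.sub_smul_eq_zero hs hη h0)⟩
  obtain ⟨a, b, h⟩ := hs.2.2 σ hσ
  refine ⟨a, b + a * c, ?_⟩
  rw [h]
  module

/-- Locally, the orthogonal projection of the timelike field to the orbits is an element of
`𝔥`. -/
theorem exists_eventually_orthogonal {ζ : VecField V} (hζ : ζ ∈ 𝔤) (htime : IsTimelike g ζ)
    (p : V) : ∃ τ ∈ 𝔥, ∀ᶠ q in 𝓝 p, ∀ σ ∈ 𝔥, g.inner (ζ - τ) σ q = 0 := by
  obtain ⟨ξ, η, hs, h0⟩ := H.exists_isSpannedBy_adapted p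
  have T := H.triple hs hζ htime p
  have hp := mem_extChartAt_source (I := 𝓡 4) p
  have hx := mem_extChartAt_target (I := 𝓡 4) p
  obtain ⟨a, b, hab⟩ := T.exists_eventually_orthogonal (by simp) hx (by
    rcases h0 with h0 | h0
    · left
      rwa [gramDet_chartField ζ hx, (extChartAt (𝓡 4) p).left_inv hp]
    · right
      apply chartSymmDeriv_injective hx
      change chartSymmDeriv p _ (chartField p ξ _) = _
      rw [chartSymmDeriv_chartField hx, (extChartAt (𝓡 4) p).left_inv hp, map_zero]
      exact h0)
  refine ⟨a • ξ + b • η, hs.smul_add_smul_mem a b, ?_⟩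
  filter_upwards [(continuousAt_extChartAt p).eventually hab,
    (isOpen_extChartAt_source p).eventually_mem hp] with q hq hqs σ hσ
  have hxq := (extChartAt (𝓡 4) p).map_source hqs
  have key : ∀ Y, chartMetric g p (extChartAt (𝓡 4) p q)
      (chartField p ζ (extChartAt (𝓡 4) p q) - (a • chartField p ξ (extChartAt (𝓡 4) p q)
        + b • chartField p η (extChartAt (𝓡 4) p q))) (chartField p Y (extChartAt (𝓡 4) p q))
      = g.inner (ζ - (a • ξ + b • η)) Y q := by
    intro Y
    rw [← chartField_smul_add_smul hxq, ← chartField_sub hxq, chartMetric_chartField g hxq,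
      (extChartAt (𝓡 4) p).left_inv hqs]
  obtain ⟨c, d, rfl⟩ := hs.2.2 σ hσ
  rw [inner_comm, inner_smul_add_smul_left, inner_comm ξ, inner_comm η, ← key ξ, ← key η]
  have e1 := hq.1
  have e2 := hq.2
  change chartMetric g p (extChartAt (𝓡 4) p q)
      (chartField p ζ (extChartAt (𝓡 4) p q) - (a • chartField p ξ (extChartAt (𝓡 4) p q)
        + b • chartField p η (extChartAt (𝓡 4) p q))) (chartField p ξ (extChartAt (𝓡 4) p q))
      = 0 at e1
  change chartMetric g p (extChartAt (𝓡 4) p q)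
      (chartField p ζ (extChartAt (𝓡 4) p q) - (a • chartField p ξ (extChartAt (𝓡 4) p q)
        + b • chartField p η (extChartAt (𝓡 4) p q))) (chartField p η (extChartAt (𝓡 4) p q))
      = 0 at e2
  rw [e1, e2, mul_zero, mul_zero, add_zero]

theorem eq_of_eventually_orthogonal {ζ τ τ' : VecField V} (hτ : τ ∈ 𝔥) (hτ' : τ' ∈ 𝔥) {p : V}
    (h : ∀ᶠ q in 𝓝 p, ∀ σ ∈ 𝔥, g.inner (ζ - τ) σ q = 0)
    (h' : ∀ᶠ q in 𝓝 p, ∀ σ ∈ 𝔥, g.inner (ζ - τ') σ q = 0) : τ = τ' := by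
  obtain ⟨ξ, η, hs⟩ := exists_isSpannedBy H.rank_eq
  obtain ⟨q, hD, hq, hq'⟩ := ((mem_closure_iff_frequently.1
    (H.dense_fieldGramDet hs p)).and_eventually (h.and h')).exists
  obtain ⟨a, b, hab⟩ := hs.2.2 _ (𝔥.sub_mem hτ hτ')
  have horth : ∀ σ ∈ 𝔥, g.inner (τ - τ') σ q = 0 := by
    intro σ hσ
    have h1 := hq σ hσ
    have h2 := hq' σ hσ
    rw [inner_sub_left] at h1 h2 ⊢
    linarith
  have f0 := horth ξ hs.1
  have f1 := horth η hs.2.1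
  rw [hab, inner_smul_add_smul_left] at f0 f1
  rw [inner_comm η ξ] at f0
  change fieldGramDet g ξ η q ≠ 0 at hD
  have ha : a = 0 := by
    refine (mul_eq_zero.1 ?_).resolve_left hD
    simp only [fieldGramDet]
    linear_combination (g.inner η η q) * f0 - (g.inner ξ η q) * f1
  have hb : b = 0 := by
    refine (mul_eq_zero.1 ?_).resolve_left hD
    simp only [fieldGramDet]
    linear_combination (g.inner ξ ξ q) * f1 - (g.inner ξ η q) * f0
  rw [ha, hb, zero_smul, zero_smul, add_zero, sub_eq_zero] at hab
  exact hab

/-- The orthogonal projection of the timelike field to the orbits is an element of `𝔥`. -/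
theorem exists_orthogonal [ConnectedSpace V] {ζ : VecField V} (hζ : ζ ∈ 𝔤)
    (htime : IsTimelike g ζ) : ∃ τ ∈ 𝔥, ∀ q, ∀ σ ∈ 𝔥, g.inner (ζ - τ) σ q = 0 := by
  let P : V → V → Prop := fun p p' ↦ ∃ τ ∈ 𝔥,
    (∀ᶠ q in 𝓝 p, ∀ σ ∈ 𝔥, g.inner (ζ - τ) σ q = 0) ∧
    (∀ᶠ q in 𝓝 p', ∀ σ ∈ 𝔥, g.inner (ζ - τ) σ q = 0)
  have hP : ∀ p p', P p p' := fun p p' ↦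
    isPreconnected_univ.induction₂ P
      (fun p _ ↦ by
        obtain ⟨τ, hτ, h⟩ := H.exists_eventually_orthogonal hζ htime p
        rw [nhdsWithin_univ]
        exact h.eventually_nhds.mono fun q hq ↦ ⟨τ, hτ, h, hq⟩)
      (fun p p' p'' _ _ _ ⟨τ, hτ, h1, h2⟩ ⟨τ', hτ', h2', h3⟩ ↦
        ⟨τ, hτ, h1, by rwa [H.eq_of_eventually_orthogonal hτ hτ' h2 h2']⟩)
      (fun p p' _ _ ⟨τ, hτ, h1, h2⟩ ↦ ⟨τ, hτ, h2, h1⟩) (Set.mem_univ p) (Set.mem_univ p')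
  obtain ⟨p₀⟩ := (inferInstance : Nonempty V)
  obtain ⟨τ, hτ, h, -⟩ := hP p₀ p₀
  refine ⟨τ, hτ, fun q ↦ ?_⟩
  obtain ⟨τ', hτ', h1, h2⟩ := hP p₀ q
  rw [H.eq_of_eventually_orthogonal hτ hτ' h h1]
  exact h2.self_of_nhds

/-- A timelike field of `𝔤` which is orthogonal to the orbits of `𝔥` is integrable. -/
theorem isIntegrable {s : VecField V} (hs : s ∈ 𝔤) (htime : IsTimelike g s)
    (horth : ∀ q, ∀ σ ∈ 𝔥, g.inner s σ q = 0) : IsIntegrable g s := by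
  intro p Y hY
  obtain ⟨ξ, η, hspan⟩ := exists_isSpannedBy H.rank_eq
  have T := H.triple hspan hs htime p
  have hp := mem_extChartAt_source (I := 𝓡 4) p
  have hx := mem_extChartAt_target (I := 𝓡 4) p
  have hinv := (extChartAt (𝓡 4) p).left_inv hp
  have key := T.wedge_dFlat_eq_zero (by simp)
    (fun y hy ↦ (chartMetric_chartField g hy s ξ).trans (horth _ ξ hspan.1))
    (fun y hy ↦ (chartMetric_chartField g hy s η).trans (horth _ η hspan.2.1)) hx
    (fun i ↦ chartField p (Y i) (extChartAt (𝓡 4) p p))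
  have hin : ∀ i, chartMetric g p (extChartAt (𝓡 4) p p) (chartField p s (extChartAt (𝓡 4) p p))
      (chartField p (Y i) (extChartAt (𝓡 4) p p)) = g.inner s (Y i) p := by
    intro i
    rw [chartMetric_chartField g hx, hinv]
  have hd : ∀ i j, dFlat (chartMetric g p) (chartField p s) (extChartAt (𝓡 4) p p)
      (chartField p (Y i) (extChartAt (𝓡 4) p p)) (chartField p (Y j) (extChartAt (𝓡 4) p p))
      = g.d s (Y i) (Y j) p := by
    intro i j
    rw [← d_eq_dFlat hx ((H.killing s hs).smooth _) (by rw [hinv]; exact hY i)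
      (by rw [hinv]; exact hY j), hinv]
  have hswap : ∀ i j, g.d s (Y i) (Y j) p = -g.d s (Y j) (Y i) p := by
    intro i j
    rw [← hd, ← hd, dFlat_swap]
  simp only [Matrix.cons_val, hin, hd] at key
  rw [sum_sign_perm_fin_three (fun i j k ↦ g.inner s (Y i) p * g.d s (Y j) (Y k) p)]
  rw [hswap 2 1, hswap 0 2, hswap 1 0]
  linear_combination 2 * key

theorem isStatic [ConnectedSpace V] {ζ : VecField V} (hζ : ζ ∈ 𝔤) (htime : IsTimelike g ζ) :
    IsStatic g := by
  obtain ⟨τ, hτ, horth⟩ := H.exists_orthogonal hζ htime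
  have hs : ζ - τ ∈ 𝔤 := 𝔤.sub_mem hζ (H.le hτ)
  have hst : IsTimelike g (ζ - τ) := by
    intro p
    have h1 := horth p τ hτ
    have h2 := htime p
    have h3 := H.inner_self_nonneg hτ p
    have h4 : g.inner (ζ - τ) (ζ - τ) p = g.inner ζ ζ p - g.inner τ τ p := by
      rw [inner_sub_left] at h1
      rw [inner_sub_left, inner_comm ζ, inner_comm τ, inner_sub_left, inner_sub_left,
        inner_comm τ ζ]
      linarith
    rw [h4]
    linarith
  exact ⟨ζ - τ, H.killing _ hs, hst, H.isIntegrable hs hst horth⟩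

end OrthTransitiveAlgebra

end Projection

end Spacetime

theorem mainTheorem5 {V : Type*} [TopologicalSpace V] [T2Space V] [ConnectedSpace V]
    [ChartedSpace (EuclideanSpace ℝ (Fin 4)) V] [IsManifold (𝓡 4) ∞ V]
    (g : Spacetime.LorentzianMetric V)
    (h_stationary : Spacetime.IsStationary g) (h_not_static : ¬ Spacetime.IsStatic g) :
    ¬ ∃ 𝔤₃ 𝔤₂ : Submodule ℝ (Spacetime.VecField V),
      Spacetime.IsIsometryAlgebra g 3 𝔤₃ ∧
      Spacetime.IsAbelian 𝔤₃ ∧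
      (∃ ζ ∈ 𝔤₃, Spacetime.IsTimelike g ζ) ∧
      𝔤₂ ≤ 𝔤₃ ∧
      Spacetime.IsIsometryAlgebra g 2 𝔤₂ ∧
      Spacetime.ActsOnSpacelikeSurfaces g 𝔤₂ ∧
      Spacetime.IsOrthogonallyTransitive g 𝔤₂ := by
  rintro ⟨𝔤₃, 𝔤₂, h₃, habel, ⟨ζ, hζ, htime⟩, hle, h₂, hsurf, horth⟩
  exact h_not_static (Spacetime.OrthTransitiveAlgebra.isStatic
    ⟨habel, h₃.killing, hle, h₂.rank_eq, hsurf, horth⟩ hζ htime)
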